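/- Let $\alpha_1,\dots,\alpha_n\in\mathbb C$ be distinct and $p(z)=\prod_i(z-\alpha_i)$. The Jacobi Ehrlich--Aberth method for $p$ replaces simultaneously every coordinate $z_i$ of $(z_1,\dots,z_n)\in\mathbb C^n$ by $z_i-q_i(z_i)/q_i'(z_i)$, where $q_i(t)=p(t)/\prod_{j\ne i}(t-z_j)$. This extends to a rational map $\mathrm{JEA}_p\colon(\mathbb P^1)^n\dashrightarrow(\mathbb P^1)^n$, where $\mathbb P^1=\mathbb C\cup\{\infty\}$. Let $$\mathrm{CR}(a,b,c,d)=\frac{(a-c)(b-d)}{(a-d)(b-c)}.$$ **Proposition.** There is a nonempty open set $U\subset\mathbb C$ such that the following holds for all pairwise distinct $\alpha_1,\alpha_2,\alpha_3,\alpha_4\in\mathbb C$ that are, in this cyclic order, the vertices of a (possibly degenerate) parallelogram, i.e. $\alpha_1+\alpha_3=\alpha_2+\alpha_4$. Let $p(z)=\prod_{i=1}^4(z-\alpha_i)$. Then $\mathrm{JEA}_p$ has a two-cycle $\{\zeta,\zeta'\}$ ($\zeta\neq\zeta'$, $\mathrm{JEA}_p$ defined at both points and interchanging them) contained in $(\mathbb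 P^1)^4\setminus\mathbb C^4$. If moreover $\mathrm{CR}(\alpha_1,\alpha_2,\alpha_3,\alpha_4)\in U$, then, for this cycle: 1. The cycle is hyperbolic with one attracting direction: the derivative at $\zeta$ of the second iterate $\mathrm{JEA}_p\circ\mathrm{JEA}_p$ is invertible, has no eigenvalue of modulus $1$, and has exactly one eigenvalue, counted with multiplicity, of modulus less than $1$. 2. The point $\zeta$ has a local stable manifold of complex dimension one. That is, there are an open neighbourhood $N$ of $\zeta$ in $(\mathbb P^1)^4$ and a holomorphically embedded open disc $W\ni\zeta$, tangent at $\zeta$ to the attracting eigendirection, such that $W$ is exactly the set of points whose forward $\mathrm{JEA}_p$-orbit is defined for all times, lies in $N$ at all even times, and converges to $\zeta$ along the even times. 3. $W\setminus\{\zeta\}\subset\mathbb C^4$, and every point of $W\setminus\{\zeta\}$ is the starting point of a diverging orbit in $\mathbb C^4$: all its iterates $z^{(k)}$ under the Jacobi Ehrlich--Aberth method are defined and lie in $\mathbb C^4$, and $\|z^{(k)}\|\to\infty$ as $k\to\infty$. -/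

import Mathlib

open Polynomial Topology Filter
open scoped OnePoint

noncomputable section

namespace EA

/-- The Riemann sphere `ℙ¹(ℂ)`, with the topology of the one-point compactification. -/
abbrev P1 : Type := OnePoint ℂ

/-- Homogeneous coordinates: `z ↦ [z : 1]` and `∞ ↦ [1 : 0]`. -/
def hom (z : P1) : ℂ × ℂ := z.elim (1, 0) (fun t => (t, 1))

/-- The point of `ℙ¹` with homogeneous coordinates `[v.1 : v.2]` (for `v ≠ 0`). -/
def ofHom (v : ℂ × ℂ) : P1 := if v.2 = 0 then ∞ else ((v.1 / v.2 : ℂ) : P1)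

/-- The bracket `x v - y u` of `z = [x : y]` and `w = [u : v]`; it is `z - w` for finite points. -/
def br (z w : P1) : ℂ := (hom z).1 * (hom w).2 - (hom z).2 * (hom w).1

/-- The inclusion `ℂⁿ ⊆ (ℙ¹)ⁿ`. -/
def incl {n : ℕ} (z : Fin n → ℂ) : Fin n → P1 := fun i => (z i : P1)

/-- The subset `ℂⁿ` of `(ℙ¹)ⁿ`. -/
def finitePart (n : ℕ) : Set (Fin n → P1) := Set.range incl

/-! ### The Ehrlich–Aberth method on `ℂⁿ` -/

/-- The monic polynomial `∏ (X - αᵢ)`. -/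
def rootPoly {n : ℕ} (α : Fin n → ℂ) : ℂ[X] := ∏ i, (X - C (α i))

/-- The rational function `qᵢ(t) = p(t) / ∏_{j ≠ i} (t - zⱼ)`. -/
def q {n : ℕ} (p : ℂ[X]) (z : Fin n → ℂ) (i : Fin n) (t : ℂ) : ℂ :=
  p.eval t / ∏ j ∈ Finset.univ.erase i, (t - z j)

/-- `z'` is the result of one Jacobi Ehrlich–Aberth step in `ℂⁿ` from `z`: every coordinate is
simultaneously replaced by `zᵢ - qᵢ(zᵢ) / qᵢ'(zᵢ)`, no denominator being zero. -/
def IsAffineStep {n : ℕ} (p : ℂ[X]) (z z' : Fin n → ℂ) : Prop :=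
  ∀ i, (∀ j, j ≠ i → z i ≠ z j) ∧ deriv (q p z i) (z i) ≠ 0 ∧
    z' i = z i - q p z i (z i) / deriv (q p z i) (z i)

/-- An orbit in `ℂⁿ` of the Jacobi Ehrlich–Aberth method. -/
def IsAffineOrbit {n : ℕ} (p : ℂ[X]) (z : ℕ → Fin n → ℂ) : Prop :=
  ∀ k, IsAffineStep p (z k) (z (k + 1))

/-! ### The extension to a rational map of `(ℙ¹)ⁿ` -/

/-- The `i`-th component of the extension, in homogeneous coordinates. With `zᵢ = [x : y]`,
`zⱼ = [uⱼ : vⱼ]`, `A_k = x - y α_k` and `B_j = x vⱼ - y uⱼ` it is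
`[∑ α_k / A_k - ∑_{j ≠ i} uⱼ / B_j : ∑ 1 / A_k - ∑_{j ≠ i} vⱼ / B_j]`, multiplied by
`∏ A_k ∏ B_j`. These are two multihomogeneous polynomials in the coordinates of the `zⱼ`; they
are coprime if the `α_k` are pairwise distinct. -/
def stepPair {n : ℕ} (α : Fin n → ℂ) (z : Fin n → P1) (i : Fin n) : ℂ × ℂ :=
  (∑ k, α k * (∏ l ∈ Finset.univ.erase k, br (z i) (α l)) *
        (∏ j ∈ Finset.univ.erase i, br (z i) (z j))
      - ∑ j ∈ Finset.univ.erase i, (hom (z j)).1 * (∏ k, br (z i) (α k)) *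
        (∏ l ∈ (Finset.univ.erase i).erase j, br (z i) (z l)),
   ∑ k, (∏ l ∈ Finset.univ.erase k, br (z i) (α l)) *
        (∏ j ∈ Finset.univ.erase i, br (z i) (z j))
      - ∑ j ∈ Finset.univ.erase i, (hom (z j)).2 * (∏ k, br (z i) (α k)) *
        (∏ l ∈ (Finset.univ.erase i).erase j, br (z i) (z l)))

/-- `z` is not in the indeterminacy locus of the Jacobi Ehrlich–Aberth map of `(ℙ¹)ⁿ`. -/
def Defined {n : ℕ} (α : Fin n → ℂ) (z : Fin n → P1) : Prop := ∀ i, stepPair α z i ≠ 0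

/-- The Jacobi Ehrlich–Aberth map `(ℙ¹)ⁿ ⇢ (ℙ¹)ⁿ` of the polynomial `∏ (X - αᵢ)`, meaningful at
the points where it is `Defined`. -/
def JEA {n : ℕ} (α : Fin n → ℂ) (z : Fin n → P1) : Fin n → P1 := fun i => ofHom (stepPair α z i)

/-- `x` is an orbit of the Jacobi Ehrlich–Aberth map in `(ℙ¹)ⁿ`. -/
def IsOrbit {n : ℕ} (α : Fin n → ℂ) (x : ℕ → Fin n → P1) : Prop :=
  ∀ k, Defined α (x k) ∧ x (k + 1) = JEA α (x k)

/-- `(z, z')` is a two-cycle of the Jacobi Ehrlich–Aberth map. -/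
def IsTwoCycle {n : ℕ} (α : Fin n → ℂ) (z z' : Fin n → P1) : Prop :=
  Defined α z ∧ Defined α z' ∧ JEA α z = z' ∧ JEA α z' = z ∧ z ≠ z'

@[simp] theorem hom_coe (t : ℂ) : hom (t : P1) = (t, 1) := rfl

@[simp] theorem hom_infty : hom (∞ : P1) = (1, 0) := rfl

@[simp] theorem br_coe (s t : ℂ) : br (s : P1) (t : P1) = s - t := by simp [br]

theorem hasDerivAt_prod_sub {n : ℕ} (s : Finset (Fin n)) (a : Fin n → ℂ) (t : ℂ) :
    HasDerivAt (fun x : ℂ => ∏ k ∈ s, (x - a k)) (∑ k ∈ s, ∏ l ∈ s.erase k, (t - a l)) t := by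
  have h := HasDerivAt.fun_finsetProd (u := s) (x := t) (f := fun k (x : ℂ) => x - a k)
    (f' := fun _ => 1) (fun k _ => (hasDerivAt_id t).sub_const (a k))
  simpa using h

theorem sum_root_mul {n : ℕ} (s : Finset (Fin n)) (a : Fin n → ℂ) (t : ℂ) :
    ∑ k ∈ s, a k * ∏ l ∈ s.erase k, (t - a l)
      = t * (∑ k ∈ s, ∏ l ∈ s.erase k, (t - a l)) - s.card * ∏ k ∈ s, (t - a k) := by
  have : ∀ k ∈ s, a k * ∏ l ∈ s.erase k, (t - a l)
      = t * ∏ l ∈ s.erase k, (t - a l) - ∏ l ∈ s, (t - a l) := by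
    intro k hk
    rw [← Finset.mul_prod_erase s (fun l => t - a l) hk]
    ring
  rw [Finset.sum_congr rfl this, Finset.sum_sub_distrib, Finset.mul_sum]
  simp

/-- The map `JEA` of `(ℙ¹)ⁿ` extends the Ehrlich–Aberth step of `ℂⁿ`. -/
theorem IsAffineStep.jea {n : ℕ} {α z z' : Fin n → ℂ} (h : IsAffineStep (rootPoly α) z z') :
    Defined α (incl z) ∧ JEA α (incl z) = incl z' := by
  have key : ∀ i, (stepPair α (incl z) i).2 ≠ 0 ∧
      (stepPair α (incl z) i).1 / (stepPair α (incl z) i).2 = z' i := by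
    intro i
    obtain ⟨hne, hq, hz⟩ := h i
    set t := z i with ht
    set P : ℂ := ∏ k, (t - α k) with hP
    set P' : ℂ := ∑ k, ∏ l ∈ Finset.univ.erase k, (t - α l) with hP'
    set W : ℂ := ∏ j ∈ Finset.univ.erase i, (t - z j) with hW
    set W' : ℂ := ∑ j ∈ Finset.univ.erase i,
      ∏ l ∈ (Finset.univ.erase i).erase j, (t - z l) with hW'
    have hW0 : W ≠ 0 := by
      rw [hW, Finset.prod_ne_zero_iff]
      intro j hj
      exact sub_ne_zero.mpr (hne j (Finset.ne_of_mem_erase hj))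
    have hqf : q (rootPoly α) z i = fun x =>
        (∏ k, (x - α k)) / ∏ j ∈ Finset.univ.erase i, (x - z j) := by
      funext x
      simp [q, rootPoly, eval_prod]
    have hd : deriv (q (rootPoly α) z i) t = (P' * W - P * W') / W ^ 2 := by
      rw [hqf]
      exact ((hasDerivAt_prod_sub Finset.univ α t).div
        (hasDerivAt_prod_sub (Finset.univ.erase i) z t) hW0).deriv
    have hv : q (rootPoly α) z i t = P / W := by rw [hqf]
    have hcard : (((Finset.univ.erase i).card : ℕ) : ℂ) = (n : ℂ) - 1 := by
      rw [Finset.card_erase_of_mem (Finset.mem_univ i), Finset.card_univ, Fintype.card_fin,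
        Nat.cast_sub (Nat.one_le_iff_ne_zero.mpr (by have := i.2; omega))]
      simp
    have h2 : (stepPair α (incl z) i).2 = P' * W - P * W' := by
      simp only [stepPair, incl, br_coe, hom_coe, one_mul, ← ht]
      rw [← Finset.sum_mul, ← Finset.mul_sum]
    have h1 : (stepPair α (incl z) i).1 = t * (P' * W - P * W') - P * W := by
      have e1 := sum_root_mul Finset.univ α t
      have e2 := sum_root_mul (Finset.univ.erase i) z t
      rw [← hP, ← hP', Finset.card_univ, Fintype.card_fin] at e1
      rw [← hW, ← hW', hcard] at e2
      simp only [stepPair, incl, br_coe, hom_coe, ← ht]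
      rw [← Finset.sum_mul, e1]
      have : ∀ j ∈ Finset.univ.erase i, z j * (∏ k, (t - α k)) *
          (∏ l ∈ (Finset.univ.erase i).erase j, (t - z l))
          = P * (z j * ∏ l ∈ (Finset.univ.erase i).erase j, (t - z l)) := by
        intro j _
        rw [← hP]; ring
      rw [Finset.sum_congr rfl this, ← Finset.mul_sum, e2]
      ring
    have hD : P' * W - P * W' ≠ 0 := by
      intro h0
      rw [hd, h0, zero_div] at hq
      exact hq rfl
    refine ⟨by rw [h2]; exact hD, ?_⟩
    rw [h1, h2, hz, hd, hv]
    field_simp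
  refine ⟨fun i h0 => (key i).1 (by rw [h0]; rfl), ?_⟩
  funext i
  rw [JEA, ofHom, if_neg (key i).1, (key i).2]
  rfl

/-! ### Coordinates on `(ℙ¹)ⁿ`, multipliers, stable manifolds -/

/-- The standard coordinate of `ℙ¹` near `c`: it is `z ↦ z` if `c ≠ ∞`, and `z ↦ 1 / z` if
`c = ∞`. -/
def chart1 (c x : P1) : ℂ :=
  c.elim ((hom x).2 / (hom x).1) (fun _ => (hom x).1 / (hom x).2)

/-- The inverse of `chart1 c`, a holomorphic open embedding `ℂ → ℙ¹`. -/
def chart1Inv (c : P1) (t : ℂ) : P1 := c.elim (ofHom (1, t)) (fun _ => ofHom (t, 1))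

/-- The product coordinates of `(ℙ¹)ⁿ` near `c`. -/
def chart {n : ℕ} (c x : Fin n → P1) : Fin n → ℂ := fun i => chart1 (c i) (x i)

/-- The inverse of `chart c`. -/
def chartInv {n : ℕ} (c : Fin n → P1) (t : Fin n → ℂ) : Fin n → P1 :=
  fun i => chart1Inv (c i) (t i)

theorem chart_chartInv {n : ℕ} (c : Fin n → P1) (t : Fin n → ℂ) : chart c (chartInv c t) = t := by
  funext i
  simp only [chart, chartInv, chart1, chart1Inv]
  generalize c i = x
  induction x using OnePoint.rec <;> by_cases ht : t i = 0 <;> simp [ofHom, ht]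

theorem chartInv_chart_self {n : ℕ} (c : Fin n → P1) : chartInv c (chart c c) = c := by
  funext i
  simp only [chart, chartInv, chart1, chart1Inv]
  generalize c i = x
  induction x using OnePoint.rec <;> simp [ofHom]

/-- The second iterate of the Jacobi Ehrlich–Aberth map in the coordinates near `c`. -/
def localReturn {n : ℕ} (α : Fin n → ℂ) (c : Fin n → P1) (t : Fin n → ℂ) : Fin n → ℂ :=
  chart c (JEA α (JEA α (chartInv c t)))

/-- An invertible linear map without eigenvalues on the unit circle, that has precisely one
eigenvalue, counted with multiplicity, in the open unit disc. -/
def IsHyperbolicOneAttracting {n : ℕ} (L : (Fin n → ℂ) →L[ℂ] (Fin n → ℂ)) : Prop :=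
  (∀ μ ∈ L.toLinearMap.charpoly.roots, μ ≠ 0 ∧ ‖μ‖ ≠ 1) ∧
    (L.toLinearMap.charpoly.roots.filter (fun μ => ‖μ‖ < 1)).card = 1

/-- The local stable set, relative to the neighbourhood `N`, of a point `c` of period two: the
points whose forward orbit is defined, lies in `N` at all even times, and converges to `c` along
the even times. -/
def localStableSet {n : ℕ} (α : Fin n → ℂ) (c : Fin n → P1) (N : Set (Fin n → P1)) :
    Set (Fin n → P1) :=
  {x₀ | ∃ x : ℕ → Fin n → P1, IsOrbit α x ∧ x 0 = x₀ ∧ (∀ k, x (2 * k) ∈ N) ∧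
    Tendsto (fun k => x (2 * k)) atTop (𝓝 c)}

/-- `γ` is a holomorphic embedding of the open unit disc into `ℂⁿ`. -/
def IsHolomorphicDisc {n : ℕ} (γ : ℂ → Fin n → ℂ) : Prop :=
  DifferentiableOn ℂ γ (Metric.ball 0 1) ∧ (∀ s ∈ Metric.ball (0 : ℂ) 1, deriv γ s ≠ 0) ∧
    IsEmbedding ((Metric.ball (0 : ℂ) 1).domRestrict γ)

/-- The disc `γ`, written in the coordinates near `c`, is a local stable manifold of the point `c`
of period two: it passes through `c`, it is the local stable set of `c` relative to some open
neighbourhood, and it is tangent at `c` to an attracting eigenvector of the derivative `L` of the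
second iterate. -/
def IsLocalStableDisc {n : ℕ} (α : Fin n → ℂ) (c : Fin n → P1)
    (L : (Fin n → ℂ) →L[ℂ] (Fin n → ℂ)) (γ : ℂ → Fin n → ℂ) : Prop :=
  IsHolomorphicDisc γ ∧ γ 0 = chart c c ∧
    (∃ N : Set (Fin n → P1), IsOpen N ∧ c ∈ N ∧
      (fun s => chartInv c (γ s)) '' Metric.ball 0 1 = localStableSet α c N) ∧
    ∃ μ : ℂ, ‖μ‖ < 1 ∧ L (deriv γ 0) = μ • deriv γ 0

/-! ### Parallelograms -/

/-- The cross-ratio, in the normalization `CR(0, ∞, c, d) = c / d`. -/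
def CR (a b c d : ℂ) : ℂ := ((a - c) * (b - d)) / ((a - d) * (b - c))

/-- Four pairwise distinct points that are, in this cyclic order, the vertices of a parallelogram
(which may be degenerate, that is, contained in a line). -/
def IsParallelogram (α : Fin 4 → ℂ) : Prop :=
  Function.Injective α ∧ α 0 + α 2 = α 1 + α 3

end EA

end

/-! Let the parallelogram have center m and half diagonals a, b, and let c² = ab. One step exchanges
(∞, m, m + c, m − c) and (m, ∞, m − c, m + c). At m the logarithmic derivative of `q` vanishes by
central symmetry, so m goes to ∞. The coordinate ∞ goes to the sum of the roots minus the sum of the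
finite coordinates, 4m − 3m = m. At m ± c the logarithmic derivative is ±1/(2c), so the Newton
correction is ∓2c.

The method commutes with permutations of the coordinates. Hence `JEA` followed by `swapPairs` fixes
the first point, and the second iterate of `JEA` is the square of this map, which is `localMap` in
coordinates. Up to scaling the coordinates by powers of c, its derivative there depends only on w =
−2(a − b)²/c² = 8 − 8/CR. The eigenvalues are 1 − w, 1 − 64/w and e − 3, where e runs over the roots
of e² − (w + 64/w)e + 48. At w = 4, that is CR = 2, they are −3, −15 and 7 ± √52, about 14.2 and
−0.21. Exactly one of them lies in the unit disc, it is nonzero, and this persists for w near 4.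

The stable disc comes from the graph transform: `IsSaddle.exists_invariant_graph` finds a
holomorphic invariant graph of slope at most 1 over the attracting direction, and
`IsSaddle.eq_graph_of_forall_mem` shows that a point off the graph is pushed away geometrically. The
attracting eigenvector has a nonzero component along 1/z₀, and the eigenbasis is scaled so that 1/z₀
vanishes on such a graph only at the cycle itself. Every other orbit on the disc therefore stays in
ℂ⁴, while 1/z₀ (up to the swap) tends to 0; this is the divergence. `exists_isLocalStableDisc`
combines these facts. -/

noncomputable section

namespace EA

/-! ### Stable manifolds of dimension one -/

section StableManifold

variable {F : Type*} [NormedAddCommGroup F] [NormedSpace ℂ F]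

/-- On the ball of radius `r`, the map `g` is holomorphic and `ε`-close, in the Lipschitz sense, to
the linear map `(a, y) ↦ (l a, B y)`, where `l` is contracting and `B` is expanding with
inverse `C`. -/
structure IsSaddle (g : ℂ × F → ℂ × F) (l : ℂ) (B C : F →L[ℂ] F) (r ε : ℝ) : Prop where
  r_pos : 0 < r
  ε_pos : 0 < ε
  map_zero : g 0 = 0
  left_inv : ∀ y, C (B y) = y
  right_inv : ∀ y, B (C y) = y
  contract : ‖l‖ + 2 * ε < 1
  expand : ‖C‖ + 2 * ε < 1
  lower : ε < ‖l‖
  diff : DifferentiableOn ℂ g (Metric.ball 0 r)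
  fst_le : ∀ p ∈ Metric.ball (0 : ℂ × F) r, ∀ q ∈ Metric.ball (0 : ℂ × F) r,
    ‖(g p).1 - (g q).1 - l * (p.1 - q.1)‖ ≤ ε * ‖p - q‖
  snd_le : ∀ p ∈ Metric.ball (0 : ℂ × F) r, ∀ q ∈ Metric.ball (0 : ℂ × F) r,
    ‖(g p).2 - (g q).2 - B (p.2 - q.2)‖ ≤ ε * ‖p - q‖

/-- Strict differentiability at 0 makes `g` minus its linear part Lipschitz with arbitrarily small
constant on a small ball; this is the only way in which smoothness of order one enters. -/
theorem exists_isSaddle {g : ℂ × F → ℂ × F} {l : ℂ} {B C : F →L[ℂ] F} (h0 : g 0 = 0)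
    (hCB : ∀ y, C (B y) = y) (hBC : ∀ y, B (C y) = y) (hl0 : l ≠ 0) (hl : ‖l‖ < 1)
    (hC : ‖C‖ < 1) (hd : ∀ᶠ p in 𝓝 0, DifferentiableAt ℂ g p)
    (hg : HasStrictFDerivAt g ((l • ContinuousLinearMap.id ℂ ℂ).prodMap B) 0)
    {V : Set (ℂ × F)} (hV : V ∈ 𝓝 0) :
    ∃ r ε, IsSaddle g l B C r ε ∧ Metric.ball 0 r ⊆ V := by
  have hl0' : 0 < ‖l‖ := norm_pos_iff.2 hl0
  obtain ⟨ε, hε, h1, h2, h3⟩ : ∃ ε : ℝ, 0 < ε ∧ ‖l‖ + 2 * ε < 1 ∧ ‖C‖ + 2 * ε < 1 ∧ ε < ‖l‖ := by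
    -- Quarters leave room for 2ε in the contraction and expansion bounds; ‖l‖ / 2 keeps ε strictly
    -- below ‖l‖.
    refine ⟨min (min ((1 - ‖l‖) / 4) ((1 - ‖C‖) / 4)) (‖l‖ / 2), ?_, ?_, ?_, ?_⟩
    · refine lt_min (lt_min ?_ ?_) ?_ <;> linarith
    · have := (min_le_left (min ((1 - ‖l‖) / 4) ((1 - ‖C‖) / 4)) (‖l‖ / 2)).trans
        (min_le_left _ _)
      linarith
    · have := (min_le_left (min ((1 - ‖l‖) / 4) ((1 - ‖C‖) / 4)) (‖l‖ / 2)).trans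
        (min_le_right _ _)
      linarith
    · have := min_le_right (min ((1 - ‖l‖) / 4) ((1 - ‖C‖) / 4)) (‖l‖ / 2)
      linarith
  obtain ⟨s, hs, hsa⟩ := hg.approximates_deriv_on_nhds (c := ε.toNNReal)
    (Or.inr (Real.toNNReal_pos.2 hε))
  obtain ⟨r, hr, hrs⟩ := Metric.mem_nhds_iff.1 (inter_mem (inter_mem hs hd) hV)
  refine ⟨r, ε, ⟨hr, hε, h0, hCB, hBC, h1, h2, h3, fun p hp =>
    (hrs hp).1.2.differentiableWithinAt, fun p hp q hq => ?_, fun p hp q hq => ?_⟩,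
    fun p hp => (hrs hp).2⟩
  · have := (norm_fst_le _).trans (hsa p (hrs hp).1.1 q (hrs hq).1.1)
    simpa [Real.coe_toNNReal _ hε.le] using this
  · have := (norm_snd_le _).trans (hsa p (hrs hp).1.1 q (hrs hq).1.1)
    simpa [Real.coe_toNNReal _ hε.le] using this

/-- The holomorphic functions on the disc of radius `r` that vanish at `0` and have Lipschitz
constant `1`. -/
structure IsGraph (r : ℝ) (f : ℂ → F) : Prop where
  map_zero : f 0 = 0
  diff : DifferentiableOn ℂ f (Metric.ball 0 r)
  lip : ∀ a ∈ Metric.ball (0 : ℂ) r, ∀ b ∈ Metric.ball (0 : ℂ) r, ‖f a - f b‖ ≤ ‖a - b‖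

theorem IsGraph.norm_le {r : ℝ} {f : ℂ → F} (hf : IsGraph r f) {a : ℂ}
    (ha : a ∈ Metric.ball (0 : ℂ) r) : ‖f a‖ ≤ ‖a‖ := by
  have hr : 0 < r := (norm_nonneg a).trans_lt (by simpa using ha)
  simpa [hf.map_zero] using hf.lip a ha 0 (by simpa using hr)

theorem IsGraph.mem {r : ℝ} {f : ℂ → F} (hf : IsGraph r f) {a : ℂ}
    (ha : a ∈ Metric.ball (0 : ℂ) r) : (a, f a) ∈ Metric.ball (0 : ℂ × F) r := by
  have := hf.norm_le ha
  rw [mem_ball_zero_iff] at ha ⊢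
  exact max_lt ha (this.trans_lt ha)

/-- The first coordinate of the image of the point of the graph of `f` over `a`. -/
def baseMap (g : ℂ × F → ℂ × F) (f : ℂ → F) (a : ℂ) : ℂ := (g (a, f a)).1

/-- The graph transform: its fixed points are the functions with invariant graph. -/
def graphTransform (g : ℂ × F → ℂ × F) (B C : F →L[ℂ] F) (f : ℂ → F) (a : ℂ) : F :=
  C (f (baseMap g f a) - ((g (a, f a)).2 - B (f a)))

variable {g : ℂ × F → ℂ × F} {l : ℂ} {B C : F →L[ℂ] F} {r ε : ℝ}

theorem IsGraph.norm_sub {f : ℂ → F} (hf : IsGraph r f) {a b : ℂ}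
    (ha : a ∈ Metric.ball (0 : ℂ) r) (hb : b ∈ Metric.ball (0 : ℂ) r) :
    ‖((a, f a) : ℂ × F) - (b, f b)‖ = ‖a - b‖ := by
  rw [Prod.mk_sub_mk, Prod.norm_mk]
  exact max_eq_left (hf.lip a ha b hb)

namespace IsSaddle

theorem baseMap_sub (H : IsSaddle g l B C r ε) {f : ℂ → F} (hf : IsGraph r f) {a b : ℂ}
    (ha : a ∈ Metric.ball (0 : ℂ) r) (hb : b ∈ Metric.ball (0 : ℂ) r) :
    ‖baseMap g f a - baseMap g f b - l * (a - b)‖ ≤ ε * ‖a - b‖ := by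
  rw [← hf.norm_sub ha hb]
  exact H.fst_le _ (hf.mem ha) _ (hf.mem hb)

theorem baseMap_lip (H : IsSaddle g l B C r ε) {f : ℂ → F} (hf : IsGraph r f) {a b : ℂ}
    (ha : a ∈ Metric.ball (0 : ℂ) r) (hb : b ∈ Metric.ball (0 : ℂ) r) :
    ‖baseMap g f a - baseMap g f b‖ ≤ (‖l‖ + ε) * ‖a - b‖ := by
  have h1 := H.baseMap_sub hf ha hb
  have h2 := norm_sub_norm_le (baseMap g f a - baseMap g f b) (l * (a - b))
  rw [norm_mul] at h2
  linarith

theorem zero_mem (H : IsSaddle g l B C r ε) : (0 : ℂ) ∈ Metric.ball (0 : ℂ) r := by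
  simpa using H.r_pos

theorem baseMap_zero (H : IsSaddle g l B C r ε) {f : ℂ → F} (hf : IsGraph r f) :
    baseMap g f 0 = 0 := by
  have : g (0, 0) = 0 := H.map_zero
  simp [baseMap, hf.map_zero, this]

theorem norm_baseMap_le (H : IsSaddle g l B C r ε) {f : ℂ → F} (hf : IsGraph r f) {a : ℂ}
    (ha : a ∈ Metric.ball (0 : ℂ) r) : ‖baseMap g f a‖ ≤ (‖l‖ + ε) * ‖a‖ := by
  simpa [H.baseMap_zero hf] using H.baseMap_lip hf ha H.zero_mem

/-- Since ε < ‖l‖, the nonlinear part cannot cancel l · a. Thus an orbit on the graph never lands on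
the fixed point, and in the application never at infinity. -/
theorem baseMap_ne_zero (H : IsSaddle g l B C r ε) {f : ℂ → F} (hf : IsGraph r f) {a : ℂ}
    (ha : a ∈ Metric.ball (0 : ℂ) r) (ha0 : a ≠ 0) : baseMap g f a ≠ 0 := by
  intro h
  have h1 := H.baseMap_sub hf ha H.zero_mem
  rw [H.baseMap_zero hf, h] at h1
  simp only [sub_zero, zero_sub, norm_neg, norm_mul] at h1
  have := norm_pos_iff.2 ha0
  have := H.lower
  nlinarith

theorem baseMap_mem (H : IsSaddle g l B C r ε) {f : ℂ → F} (hf : IsGraph r f) {a : ℂ}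
    (ha : a ∈ Metric.ball (0 : ℂ) r) : baseMap g f a ∈ Metric.ball (0 : ℂ) r := by
  have h1 := H.norm_baseMap_le hf ha
  rw [mem_ball_zero_iff] at ha ⊢
  have := H.contract
  have := H.ε_pos
  nlinarith [norm_nonneg a]

/-- The Lipschitz constant becomes at most ‖C‖(‖l‖ + 2ε): ‖l‖ + ε from the base map and ε from the
nonlinear part of the second component. -/
theorem isGraph_graphTransform (H : IsSaddle g l B C r ε) {f : ℂ → F} (hf : IsGraph r f) :
    IsGraph r (graphTransform g B C f) := by
  have hg0 : g (0, 0) = 0 := H.map_zero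
  have hdg : DifferentiableOn ℂ (fun a => g (a, f a)) (Metric.ball 0 r) :=
    H.diff.comp (differentiableOn_id.prodMk hf.diff) fun a ha => hf.mem ha
  refine ⟨?_, ?_, fun a ha b hb => ?_⟩
  · simp [graphTransform, H.baseMap_zero hf, hf.map_zero, hg0]
  · refine C.differentiable.comp_differentiableOn (DifferentiableOn.sub ?_ (hdg.snd.sub
      (B.differentiable.comp_differentiableOn hf.diff)))
    exact hf.diff.comp hdg.fst fun a ha => H.baseMap_mem hf ha
  · have h1 := hf.lip _ (H.baseMap_mem hf ha) _ (H.baseMap_mem hf hb)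
    have h2 := H.baseMap_lip hf ha hb
    have h3 := H.snd_le _ (hf.mem ha) _ (hf.mem hb)
    rw [hf.norm_sub ha hb] at h3
    have h4 : graphTransform g B C f a - graphTransform g B C f b
        = C ((f (baseMap g f a) - f (baseMap g f b))
          - ((g (a, f a)).2 - (g (b, f b)).2 - B (f a - f b))) := by
      simp only [graphTransform, ← map_sub]
      congr 1
      rw [map_sub]
      abel
    rw [h4]
    have h5 := C.le_opNorm ((f (baseMap g f a) - f (baseMap g f b))
          - ((g (a, f a)).2 - (g (b, f b)).2 - B (f a - f b)))
    have h6 := norm_sub_le (f (baseMap g f a) - f (baseMap g f b))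
          ((g (a, f a)).2 - (g (b, f b)).2 - B (f a - f b))
    have h7 := H.contract
    have h8 := H.expand
    have h9 := H.ε_pos
    have hle : ‖(f (baseMap g f a) - f (baseMap g f b))
          - ((g (a, f a)).2 - (g (b, f b)).2 - B (f a - f b))‖ ≤ ‖a - b‖ := by
      nlinarith [norm_nonneg (a - b)]
    have hC : ‖C‖ ≤ 1 := by linarith
    exact h5.trans ((mul_le_of_le_one_left (norm_nonneg _) hC).trans hle)

/-- Inserting the value of `f₁` at the base point of `f₂` separates the shift of the base point (at
most εδ, since `f₁` is 1-Lipschitz) from the change of function (at most δ); the nonlinear part of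
the second component adds another εδ. -/
theorem graphTransform_sub_le (H : IsSaddle g l B C r ε) {f₁ f₂ : ℂ → F} (h₁ : IsGraph r f₁)
    (h₂ : IsGraph r f₂) {δ : ℝ} (hδ : ∀ a ∈ Metric.ball (0 : ℂ) r, ‖f₁ a - f₂ a‖ ≤ δ) {a : ℂ}
    (ha : a ∈ Metric.ball (0 : ℂ) r) :
    ‖graphTransform g B C f₁ a - graphTransform g B C f₂ a‖ ≤ ‖C‖ * (1 + 2 * ε) * δ := by
  have e : ‖((a, f₁ a) : ℂ × F) - (a, f₂ a)‖ = ‖f₁ a - f₂ a‖ := by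
    rw [Prod.mk_sub_mk, Prod.norm_mk, sub_self, norm_zero]
    exact max_eq_right (norm_nonneg _)
  have k1 := H.fst_le _ (h₁.mem ha) _ (h₂.mem ha)
  have k2 := H.snd_le _ (h₁.mem ha) _ (h₂.mem ha)
  rw [e] at k1 k2
  simp only [sub_self, mul_zero, sub_zero] at k1
  have k3 := h₁.lip _ (H.baseMap_mem h₁ ha) _ (H.baseMap_mem h₂ ha)
  have k4 := hδ _ (H.baseMap_mem h₂ ha)
  have k5 := hδ a ha
  have h4 : graphTransform g B C f₁ a - graphTransform g B C f₂ a
      = C (((f₁ (baseMap g f₁ a) - f₁ (baseMap g f₂ a))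
          + (f₁ (baseMap g f₂ a) - f₂ (baseMap g f₂ a)))
        - ((g (a, f₁ a)).2 - (g (a, f₂ a)).2 - B (f₁ a - f₂ a))) := by
    simp only [graphTransform, ← map_sub]
    congr 1
    rw [map_sub]
    abel
  rw [h4, mul_assoc]
  refine (C.le_opNorm _).trans (mul_le_mul_of_nonneg_left ?_ (norm_nonneg _))
  refine (norm_sub_le _ _).trans ?_
  have k6 := norm_add_le (f₁ (baseMap g f₁ a) - f₁ (baseMap g f₂ a))
    (f₁ (baseMap g f₂ a) - f₂ (baseMap g f₂ a))
  have k1' : ‖baseMap g f₁ a - baseMap g f₂ a‖ ≤ ε * ‖f₁ a - f₂ a‖ := k1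
  have := mul_le_mul_of_nonneg_left k5 H.ε_pos.le
  linarith

/-- Iterating the graph transform from 0 converges uniformly at a geometric rate, so the limit is
again holomorphic and 1-Lipschitz. Applying `B` to the fixed-point equation turns it into invariance
of the graph. -/
theorem exists_invariant_graph [CompleteSpace F] (H : IsSaddle g l B C r ε) :
    ∃ f : ℂ → F, IsGraph r f ∧
      ∀ a ∈ Metric.ball (0 : ℂ) r, g (a, f a) = (baseMap g f a, f (baseMap g f a)) := by
  set Φ : ℕ → ℂ → F := fun n => (graphTransform g B C)^[n] 0 with hΦ
  have hsucc : ∀ n, Φ (n + 1) = graphTransform g B C (Φ n) := fun n =>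
    Function.iterate_succ_apply' _ _ _
  have hgr : ∀ n, IsGraph r (Φ n) := by
    intro n
    induction n with
    | zero => exact ⟨rfl, differentiableOn_const _, fun a _ b _ => by simp [hΦ]⟩
    | succ n ih => rw [hsucc]; exact H.isGraph_graphTransform ih
  set κ : ℝ := ‖C‖ * (1 + 2 * ε) with hκ
  have hε := H.ε_pos
  have hκ0 : 0 ≤ κ := by positivity
  -- As ‖C‖ < 1, the product ‖C‖(1 + 2ε) is at most ‖C‖ + 2ε.
  have hκ1 : κ < 1 := by
    have := H.expand
    have := norm_nonneg C
    nlinarith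
  have hstep : ∀ n, ∀ a ∈ Metric.ball (0 : ℂ) r, ‖Φ n a - Φ (n + 1) a‖ ≤ r * κ ^ n := by
    intro n
    induction n with
    | zero =>
      intro a ha
      have h0 : Φ 0 a = 0 := rfl
      rw [h0, zero_sub, norm_neg, pow_zero, mul_one]
      exact ((hgr 1).norm_le ha).trans (by simpa using (mem_ball_zero_iff.1 ha).le)
    | succ n ih =>
      intro a ha
      rw [hsucc n, hsucc (n + 1)]
      refine (H.graphTransform_sub_le (hgr n) (hgr (n + 1)) ih ha).trans (le_of_eq ?_)
      rw [← hκ]; ring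
  have hc : ∀ a ∈ Metric.ball (0 : ℂ) r, ∃ y, Tendsto (fun n => Φ n a) atTop (𝓝 y) := fun a ha =>
    cauchySeq_tendsto_of_complete (cauchySeq_of_le_geometric κ r hκ1 fun n => by
      rw [dist_eq_norm]; exact hstep n a ha)
  choose! f hf using hc
  have hdist : ∀ n, ∀ a ∈ Metric.ball (0 : ℂ) r, ‖Φ n a - f a‖ ≤ r / (1 - κ) * κ ^ n := by
    intro n a ha
    have := dist_le_of_le_geometric_of_tendsto κ r hκ1 (fun n => by
      rw [dist_eq_norm]; exact hstep n a ha) (hf a ha) n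
    rw [dist_eq_norm] at this
    refine this.trans (le_of_eq (by ring))
  have hlim : Tendsto (fun n => r / (1 - κ) * κ ^ n) atTop (𝓝 0) := by
    simpa using (tendsto_pow_atTop_nhds_zero_of_lt_one hκ0 hκ1).const_mul (r / (1 - κ))
  have hunif : TendstoUniformlyOn Φ f atTop (Metric.ball 0 r) := by
    rw [Metric.tendstoUniformlyOn_iff]
    intro δ hδ
    filter_upwards [hlim.eventually_lt_const hδ] with n hn a ha
    rw [dist_comm, dist_eq_norm]
    exact (hdist n a ha).trans_lt hn
  have hfg : IsGraph r f := by
    refine ⟨?_, hunif.tendstoLocallyUniformlyOn.differentiableOn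
      (Eventually.of_forall fun n => (hgr n).diff) Metric.isOpen_ball, fun a ha b hb => ?_⟩
    · refine tendsto_nhds_unique (hf 0 H.zero_mem) ?_
      simp only [(hgr _).map_zero, tendsto_const_nhds]
    · exact le_of_tendsto ((hf a ha).sub (hf b hb)).norm
        (Eventually.of_forall fun n => (hgr n).lip a ha b hb)
  refine ⟨f, hfg, fun a ha => ?_⟩
  have hfix : graphTransform g B C f a = f a := by
    have h1 : Tendsto (fun n => Φ (n + 1) a) atTop (𝓝 (graphTransform g B C f a)) := by
      rw [tendsto_iff_norm_sub_tendsto_zero]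
      refine squeeze_zero (fun _ => norm_nonneg _) (fun n => ?_) (by simpa using hlim.const_mul κ)
      rw [hsucc]
      exact H.graphTransform_sub_le (hgr n) hfg (hdist n) ha
    exact tendsto_nhds_unique h1 ((tendsto_add_atTop_iff_nat 1).2 (hf a ha))
  have h2 := congrArg B hfix
  rw [graphTransform, H.right_inv, sub_eq_iff_eq_add, add_sub_cancel] at h2
  exact Prod.ext rfl h2.symm

/-- Differentiating the invariance at 0 gives B f'(0) = l f'(0), hence f'(0) = l C f'(0), and ‖C‖‖l‖
< 1 forces f'(0) = 0. The graph is tangent to the attracting axis. -/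
theorem hasDerivAt_graph (H : IsSaddle g l B C r ε)
    (hg : HasFDerivAt g ((l • ContinuousLinearMap.id ℂ ℂ).prodMap B) 0) {f : ℂ → F}
    (hf : IsGraph r f)
    (hinv : ∀ a ∈ Metric.ball (0 : ℂ) r, g (a, f a) = (baseMap g f a, f (baseMap g f a))) :
    HasDerivAt f 0 0 := by
  have hball : Metric.ball (0 : ℂ) r ∈ 𝓝 0 := Metric.ball_mem_nhds 0 H.r_pos
  have hfd : HasDerivAt f (deriv f 0) 0 := (hf.diff.differentiableAt hball).hasDerivAt
  have h1 : HasDerivAt (fun a => ((a, f a) : ℂ × F)) (1, deriv f 0) 0 :=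
    (hasDerivAt_id 0).prodMk hfd
  have hg' : HasFDerivAt g ((l • ContinuousLinearMap.id ℂ ℂ).prodMap B) ((0 : ℂ), f 0) := by
    rw [hf.map_zero]; exact hg
  have h2 := hg'.comp_hasDerivAt (0 : ℂ) h1
  have h3 : HasDerivAt (fun a => (g (a, f a)).2) (B (deriv f 0)) 0 := h2.snd
  have h4 : HasDerivAt (baseMap g f) (l • (1 : ℂ)) 0 := h2.fst
  rw [smul_eq_mul, mul_one] at h4
  have hfd' : HasDerivAt f (deriv f 0) (baseMap g f 0) := by rw [H.baseMap_zero hf]; exact hfd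
  have h5 : HasDerivAt (fun a => f (baseMap g f a)) (l • deriv f 0) 0 := hfd'.scomp 0 h4
  have h6 : (fun a => (g (a, f a)).2) =ᶠ[𝓝 0] fun a => f (baseMap g f a) := by
    filter_upwards [hball] with a ha
    rw [hinv a ha]
  have h7 : B (deriv f 0) = l • deriv f 0 := h3.unique (h5.congr_of_eventuallyEq h6)
  have h8 : deriv f 0 = C (l • deriv f 0) := by rw [← h7, H.left_inv]
  have h9 : ‖deriv f 0‖ ≤ ‖C‖ * (‖l‖ * ‖deriv f 0‖) := by
    rw [← norm_smul]
    exact (le_of_eq (congrArg norm h8)).trans (C.le_opNorm _)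
  have : deriv f 0 = 0 := by
    by_contra hne
    have hp := norm_pos_iff.2 hne
    have h10 : ‖C‖ * ‖l‖ < 1 := by
      have := H.contract
      have := H.expand
      have := H.ε_pos
      nlinarith [norm_nonneg C, norm_nonneg l]
    nlinarith
  rwa [this] at hfd

/-- The cone of mostly vertical differences is mapped into itself, and the vertical part grows at
least by the factor (1 − ε)/‖C‖ > 1. -/
theorem expand_step (H : IsSaddle g l B C r ε) {p q : ℂ × F} (hp : p ∈ Metric.ball (0 : ℂ × F) r)
    (hq : q ∈ Metric.ball (0 : ℂ × F) r) (h : ‖p.1 - q.1‖ ≤ ‖p.2 - q.2‖) :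
    ‖(g p).1 - (g q).1‖ ≤ ‖(g p).2 - (g q).2‖ ∧
      (1 - ε) * ‖p.2 - q.2‖ ≤ ‖C‖ * ‖(g p).2 - (g q).2‖ := by
  have hn : ‖p - q‖ = ‖p.2 - q.2‖ := max_eq_right h
  have h1 := H.fst_le p hp q hq
  have h2 := H.snd_le p hp q hq
  rw [hn] at h1 h2
  have h3 := norm_sub_norm_le ((g p).1 - (g q).1) (l * (p.1 - q.1))
  have h4 := norm_sub_norm_le (B (p.2 - q.2)) ((g p).2 - (g q).2)
  rw [norm_sub_rev (B _)] at h4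
  have h5 := C.le_opNorm (B (p.2 - q.2))
  rw [H.left_inv] at h5
  rw [norm_mul] at h3
  have hε := H.ε_pos
  have hc := H.contract
  have he := H.expand
  have h6 : (1 - ε) * ‖p.2 - q.2‖ ≤ ‖C‖ * ‖(g p).2 - (g q).2‖ := by
    have : ‖C‖ * ‖B (p.2 - q.2)‖ ≤ ‖C‖ * (‖(g p).2 - (g q).2‖ + ε * ‖p.2 - q.2‖) :=
      mul_le_mul_of_nonneg_left (by linarith) (norm_nonneg _)
    have : ‖C‖ * (ε * ‖p.2 - q.2‖) ≤ 1 * (ε * ‖p.2 - q.2‖) :=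
      mul_le_mul_of_nonneg_right (by linarith) (by positivity)
    linarith
  refine ⟨?_, h6⟩
  have h7 : ‖C‖ * ‖(g p).2 - (g q).2‖ ≤ 1 * ‖(g p).2 - (g q).2‖ :=
    mul_le_mul_of_nonneg_right (by linarith) (norm_nonneg _)
  have h8 : ‖l‖ * ‖p.1 - q.1‖ ≤ ‖l‖ * ‖p.2 - q.2‖ := mul_le_mul_of_nonneg_left h (norm_nonneg _)
  nlinarith [norm_nonneg (p.2 - q.2)]

theorem iterate_graph {f : ℂ → F} (H : IsSaddle g l B C r ε) (hf : IsGraph r f)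
    (hinv : ∀ a ∈ Metric.ball (0 : ℂ) r, g (a, f a) = (baseMap g f a, f (baseMap g f a)))
    {a : ℂ} (ha : a ∈ Metric.ball (0 : ℂ) r) (k : ℕ) :
    ∃ b ∈ Metric.ball (0 : ℂ) r, g^[k] (a, f a) = (b, f b) ∧ ‖b‖ ≤ (‖l‖ + ε) ^ k * ‖a‖ ∧
      (a ≠ 0 → b ≠ 0) := by
  induction k with
  | zero => exact ⟨a, ha, rfl, by simp, id⟩
  | succ k ih =>
    obtain ⟨b, hb, h1, h2, h3⟩ := ih
    refine ⟨baseMap g f b, H.baseMap_mem hf hb, ?_, ?_, fun h => H.baseMap_ne_zero hf hb (h3 h)⟩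
    · rw [Function.iterate_succ_apply', h1, hinv b hb]
    · refine (H.norm_baseMap_le hf hb).trans ?_
      rw [pow_succ', mul_assoc]
      exact mul_le_mul_of_nonneg_left h2 (add_nonneg (norm_nonneg _) H.ε_pos.le)

/-- A point whose orbit stays in the ball lies on the invariant graph. -/
theorem eq_graph_of_forall_mem {f : ℂ → F} (H : IsSaddle g l B C r ε) (hf : IsGraph r f)
    (hinv : ∀ a ∈ Metric.ball (0 : ℂ) r, g (a, f a) = (baseMap g f a, f (baseMap g f a)))
    {p : ℂ × F} (hp : ∀ k, g^[k] p ∈ Metric.ball (0 : ℂ × F) r) : p.2 = f p.1 := by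
  have hp1 : p.1 ∈ Metric.ball (0 : ℂ) r := by
    have := hp 0
    rw [Function.iterate_zero_apply, mem_ball_zero_iff] at this
    exact mem_ball_zero_iff.2 ((norm_fst_le p).trans_lt this)
  -- The comparison point is the graph point directly below p, so the initial difference is purely
  -- vertical and lies in the expanding cone. As both orbits are bounded, the difference must
  -- vanish.
  set q : ℂ × F := (p.1, f p.1) with hq
  have hqm : ∀ k, g^[k] q ∈ Metric.ball (0 : ℂ × F) r := by
    intro k
    obtain ⟨b, hb, h1, -⟩ := H.iterate_graph hf hinv hp1 k
    rw [hq, h1]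
    exact hf.mem hb
  have hε := H.ε_pos
  have hc := H.contract
  have he := H.expand
  have hε1 : 0 < 1 - ε := by linarith [norm_nonneg C]
  set θ : ℝ := ‖C‖ / (1 - ε) with hθ
  have hθ0 : 0 ≤ θ := div_nonneg (norm_nonneg _) hε1.le
  have hθ1 : θ < 1 := by rw [hθ, div_lt_one hε1]; linarith
  have key : ∀ k, ‖(g^[k] p).1 - (g^[k] q).1‖ ≤ ‖(g^[k] p).2 - (g^[k] q).2‖ ∧
      ‖p.2 - f p.1‖ ≤ θ ^ k * ‖(g^[k] p).2 - (g^[k] q).2‖ := by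
    intro k
    induction k with
    | zero => simp [hq]
    | succ k ih =>
      obtain ⟨h1, h2⟩ := H.expand_step (hp k) (hqm k) ih.1
      rw [Function.iterate_succ_apply', Function.iterate_succ_apply']
      refine ⟨h1, ih.2.trans ?_⟩
      rw [pow_succ, mul_assoc]
      refine mul_le_mul_of_nonneg_left ?_ (pow_nonneg hθ0 k)
      rw [hθ, div_mul_eq_mul_div, le_div_iff₀ hε1]
      linarith
  have hb : ∀ k, ‖p.2 - f p.1‖ ≤ θ ^ k * (2 * r) := by
    intro k
    refine (key k).2.trans (mul_le_mul_of_nonneg_left ?_ (pow_nonneg hθ0 k))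
    have h1 := (norm_snd_le _).trans_lt (mem_ball_zero_iff.1 (hp k))
    have h2 := (norm_snd_le _).trans_lt (mem_ball_zero_iff.1 (hqm k))
    have := norm_sub_le (g^[k] p).2 (g^[k] q).2
    linarith
  have hlim : Tendsto (fun k => θ ^ k * (2 * r)) atTop (𝓝 0) := by
    simpa using (tendsto_pow_atTop_nhds_zero_of_lt_one hθ0 hθ1).mul_const (2 * r)
  have : ‖p.2 - f p.1‖ ≤ 0 := ge_of_tendsto' hlim hb
  exact sub_eq_zero.1 (norm_le_zero_iff.1 this)

end IsSaddle

end StableManifold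

/-! ### Homogeneous coordinates and permutations -/

theorem ofHom_smul {s : ℂ} (hs : s ≠ 0) (v : ℂ × ℂ) : ofHom (s • v) = ofHom v := by
  by_cases h : v.2 = 0
  · simp [ofHom, h]
  · simp [ofHom, h, hs, mul_div_mul_left]

theorem ofHom_of_ne {v : ℂ × ℂ} (h : v.2 ≠ 0) : ofHom v = ((v.1 / v.2 : ℂ) : P1) := if_neg h

theorem ofHom_coe_one (t : ℂ) : ofHom (t, 1) = (t : P1) := by simp [ofHom]

theorem ofHom_eq_one_div {v : ℂ × ℂ} (h : v.1 ≠ 0) : ofHom v = ofHom (1, v.2 / v.1) := by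
  rw [← ofHom_smul h (1, v.2 / v.1)]
  congr 1
  ext <;> simp [mul_div_cancel₀, h]

/-- `hom` normalizes ∞ and finite points differently; the factor κ allows one formula to cover u = 0
and u ≠ 0 in the coordinate at ∞. -/
theorem exists_hom_ofHom (u : ℂ) : ∃ κ : ℂ, κ ≠ 0 ∧ hom (ofHom (1, u)) = (κ, κ * u) := by
  by_cases h : u = 0
  · exact ⟨1, one_ne_zero, by simp [ofHom, h]⟩
  · exact ⟨u⁻¹, inv_ne_zero h, by simp [ofHom, h]⟩

/-- Away from coincidences the polynomial form can be divided by the product of all brackets, which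
leaves partial fractions. -/
theorem stepPair_eq_smul {n : ℕ} (α : Fin n → ℂ) (z : Fin n → P1) (i : Fin n)
    (hA : ∀ k, br (z i) (α k) ≠ 0) (hB : ∀ j, j ≠ i → br (z i) (z j) ≠ 0) :
    ∃ s : ℂ, s ≠ 0 ∧ stepPair α z i =
      s • (∑ k, α k / br (z i) (α k)
            - ∑ j ∈ Finset.univ.erase i, (hom (z j)).1 / br (z i) (z j),
          ∑ k, 1 / br (z i) (α k)
            - ∑ j ∈ Finset.univ.erase i, (hom (z j)).2 / br (z i) (z j)) := by
  have hB' : ∀ j ∈ Finset.univ.erase i, br (z i) (z j) ≠ 0 := fun j hj =>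
    hB j (Finset.ne_of_mem_erase hj)
  have eA : ∀ k, ∏ l ∈ Finset.univ.erase k, br (z i) (α l)
      = (∏ l, br (z i) (α l)) / br (z i) (α k) := fun k => by
    rw [eq_div_iff (hA k), Finset.prod_erase_mul _ _ (Finset.mem_univ k)]
  have eB : ∀ j ∈ Finset.univ.erase i, ∏ l ∈ (Finset.univ.erase i).erase j, br (z i) (z l)
      = (∏ l ∈ Finset.univ.erase i, br (z i) (z l)) / br (z i) (z j) := fun j hj => by
    rw [eq_div_iff (hB' j hj), Finset.prod_erase_mul _ _ hj]
  refine ⟨(∏ l, br (z i) (α l)) * ∏ l ∈ Finset.univ.erase i, br (z i) (z l),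
    mul_ne_zero (Finset.prod_ne_zero_iff.2 fun k _ => hA k) (Finset.prod_ne_zero_iff.2 hB'), ?_⟩
  rw [stepPair]
  ext
  · simp only [Prod.smul_mk, smul_eq_mul, mul_sub, Finset.mul_sum]
    refine congrArg₂ _ (Finset.sum_congr rfl fun k _ => ?_) (Finset.sum_congr rfl fun j hj => ?_)
    · rw [eA]; ring
    · rw [eB j hj]; ring
  · simp only [Prod.smul_mk, smul_eq_mul, mul_sub, Finset.mul_sum]
    refine congrArg₂ _ (Finset.sum_congr rfl fun k _ => ?_) (Finset.sum_congr rfl fun j hj => ?_)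
    · rw [eA]; ring
    · rw [eB j hj]; ring

theorem stepPair_comp_perm {n : ℕ} (α : Fin n → ℂ) (z : Fin n → P1) (σ : Equiv.Perm (Fin n))
    (i : Fin n) : stepPair α (z ∘ σ) i = stepPair α z (σ i) := by
  have hs : Finset.univ.erase (σ i) = (Finset.univ.erase i).map σ.toEmbedding := by
    rw [Finset.map_erase, Finset.map_univ_equiv]; rfl
  have hs2 : ∀ j, ((Finset.univ.erase i).map σ.toEmbedding).erase (σ j)
      = ((Finset.univ.erase i).erase j).map σ.toEmbedding := fun j =>
    (Finset.map_erase _ _ _).symm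
  simp only [stepPair, hs, Finset.sum_map, Finset.prod_map, Equiv.coe_toEmbedding, hs2,
    Function.comp_apply]

/-- This symmetry turns the two-cycle into a fixed point of `JEA` composed with a permutation. -/
theorem JEA_comp_perm {n : ℕ} (α : Fin n → ℂ) (z : Fin n → P1) (σ : Equiv.Perm (Fin n)) :
    JEA α (z ∘ σ) = JEA α z ∘ σ := by
  funext i
  simp only [JEA, stepPair_comp_perm, Function.comp_apply]

theorem Defined.comp_perm {n : ℕ} {α : Fin n → ℂ} {z : Fin n → P1} (h : Defined α z)
    (σ : Equiv.Perm (Fin n)) : Defined α (z ∘ σ) := fun i => by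
  rw [stepPair_comp_perm]; exact h _

theorem q_comp_perm {n : ℕ} (p : ℂ[X]) (z : Fin n → ℂ) (σ : Equiv.Perm (Fin n)) (i : Fin n) :
    q p (z ∘ σ) i = q p z (σ i) := by
  have hs : Finset.univ.erase (σ i) = (Finset.univ.erase i).map σ.toEmbedding := by
    rw [Finset.map_erase, Finset.map_univ_equiv]; rfl
  funext t
  simp only [q, hs, Finset.prod_map, Equiv.coe_toEmbedding, Function.comp_apply]

theorem IsAffineStep.comp_perm {n : ℕ} {p : ℂ[X]} {z z' : Fin n → ℂ} (h : IsAffineStep p z z')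
    (σ : Equiv.Perm (Fin n)) : IsAffineStep p (z ∘ σ) (z' ∘ σ) := fun i => by
  obtain ⟨h1, h2, h3⟩ := h (σ i)
  simp only [Function.comp_apply, q_comp_perm]
  exact ⟨fun j hj => h1 _ (σ.injective.ne hj), h2, h3⟩

/-- Where qᵢ does not vanish, qᵢ / qᵢ' is the reciprocal of the logarithmic derivative, a sum over
the roots minus a sum over the other coordinates. -/
theorem isAffineStep_of_logDeriv {n : ℕ} {α z z' : Fin n → ℂ}
    (hα : ∀ i k, z i ≠ α k) (hz : ∀ i j, j ≠ i → z i ≠ z j)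
    (hD : ∀ i, ∑ k, 1 / (z i - α k) - ∑ j ∈ Finset.univ.erase i, 1 / (z i - z j) ≠ 0)
    (hz' : ∀ i, z' i = z i
      - 1 / (∑ k, 1 / (z i - α k) - ∑ j ∈ Finset.univ.erase i, 1 / (z i - z j))) :
    IsAffineStep (rootPoly α) z z' := by
  intro i
  have hW : ∀ j ∈ Finset.univ.erase i, z i - z j ≠ 0 := fun j hj =>
    sub_ne_zero.2 (hz i j (Finset.ne_of_mem_erase hj))
  have hP : ∀ k, z i - α k ≠ 0 := fun k => sub_ne_zero.2 (hα i k)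
  have hW0 := Finset.prod_ne_zero_iff.2 hW
  have hP0 : ∏ k, (z i - α k) ≠ 0 := Finset.prod_ne_zero_iff.2 fun k _ => hP k
  have hqf : q (rootPoly α) z i = fun x =>
      (∏ k, (x - α k)) / ∏ j ∈ Finset.univ.erase i, (x - z j) := by
    funext x
    simp [q, rootPoly, eval_prod]
  have eA : ∑ k, ∏ l ∈ Finset.univ.erase k, (z i - α l)
      = (∏ l, (z i - α l)) * ∑ k, 1 / (z i - α k) := by
    rw [Finset.mul_sum]
    refine Finset.sum_congr rfl fun k _ => ?_
    rw [mul_one_div, eq_div_iff (hP k), Finset.prod_erase_mul _ _ (Finset.mem_univ k)]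
  have eB : ∑ j ∈ Finset.univ.erase i, ∏ l ∈ (Finset.univ.erase i).erase j, (z i - z l)
      = (∏ l ∈ Finset.univ.erase i, (z i - z l)) * ∑ j ∈ Finset.univ.erase i, 1 / (z i - z j) := by
    rw [Finset.mul_sum]
    refine Finset.sum_congr rfl fun j hj => ?_
    rw [mul_one_div, eq_div_iff (hW j hj), Finset.prod_erase_mul _ _ hj]
  have hd := ((hasDerivAt_prod_sub Finset.univ α (z i)).div
    (hasDerivAt_prod_sub (Finset.univ.erase i) z (z i)) hW0).deriv
  have hv : q (rootPoly α) z i (z i) = (∏ k, (z i - α k)) /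
      ∏ j ∈ Finset.univ.erase i, (z i - z j) := by rw [hqf]
  have hd' : deriv (q (rootPoly α) z i) (z i) = (∏ k, (z i - α k)) /
      (∏ j ∈ Finset.univ.erase i, (z i - z j)) *
        (∑ k, 1 / (z i - α k) - ∑ j ∈ Finset.univ.erase i, 1 / (z i - z j)) := by
    rw [hqf]
    refine hd.trans ?_
    rw [eA, eB]
    field_simp
  have hr : (∏ k, (z i - α k)) / (∏ j ∈ Finset.univ.erase i, (z i - z j)) ≠ 0 :=
    div_ne_zero hP0 hW0
  refine ⟨hz i, ?_, ?_⟩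
  · rw [hd']; exact mul_ne_zero hr (hD i)
  · rw [hd', hv, hz' i, ← div_div, div_self hr]

/-! ### Topology of the coordinates -/

theorem isOpenMap_ofHom_one : IsOpenMap fun t : ℂ => ofHom (1, t) := by
  intro s hs
  have hpre : ((↑) : ℂ → P1) ⁻¹' ((fun t : ℂ => ofHom (1, t)) '' s) = {x | x ≠ 0 ∧ x⁻¹ ∈ s} := by
    ext x
    constructor
    · rintro ⟨t, ht, hx⟩
      by_cases h : t = 0
      · simp [ofHom, h] at hx
      · have : t⁻¹ = x := by simpa [ofHom, h] using hx
        subst this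
        exact ⟨inv_ne_zero h, by simpa using ht⟩
    · rintro ⟨h0, hx⟩
      exact ⟨x⁻¹, hx, by simp [ofHom, h0]⟩
  have hopen : IsOpen {x : ℂ | x ≠ 0 ∧ x⁻¹ ∈ s} :=
    (continuousOn_inv₀ (G₀ := ℂ)).isOpen_inter_preimage isOpen_ne hs
  rw [OnePoint.isOpen_def, hpre]
  refine ⟨?_, hopen⟩
  rintro ⟨t, ht, hx⟩
  have h0 : t = 0 := by
    by_contra h
    simp [ofHom, h] at hx
  subst h0
  -- A ball of radius δ about 0 covers, after inversion, everything outside the ball of radius 1/δ;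
  -- so the complement of the image is compact.
  obtain ⟨δ, hδ, hδs⟩ := Metric.isOpen_iff.1 hs 0 ht
  refine (isCompact_closedBall (0 : ℂ) δ⁻¹).of_isClosed_subset hopen.isClosed_compl ?_
  intro x hx
  rw [mem_closedBall_zero_iff]
  by_contra! hlt
  have hx0 : x ≠ 0 := norm_pos_iff.1 ((inv_pos.2 hδ).trans hlt)
  refine hx ⟨hx0, hδs ?_⟩
  rw [mem_ball_zero_iff, norm_inv]
  exact inv_lt_of_inv_lt₀ hδ hlt

theorem isOpenMap_chart1Inv (c : P1) : IsOpenMap (chart1Inv c) := by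
  induction c using OnePoint.rec with
  | infty => exact isOpenMap_ofHom_one
  | coe x =>
    have : chart1Inv (x : P1) = ((↑) : ℂ → P1) := by
      funext t; exact ofHom_coe_one t
    rw [this]
    exact OnePoint.isOpenMap_coe

theorem isOpenMap_chartInv {n : ℕ} (c : Fin n → P1) : IsOpenMap (chartInv c) :=
  IsOpenMap.piMap (fun i => isOpenMap_chart1Inv (c i)) (by simp)

theorem chartInv_injective {n : ℕ} (c : Fin n → P1) : Function.Injective (chartInv c) :=
  Function.LeftInverse.injective (chart_chartInv c)

theorem continuousAt_ofHom_one : ContinuousAt (fun t : ℂ => ofHom (1, t)) 0 := by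
  have h0 : ofHom (1, 0) = ∞ := by simp [ofHom]
  rw [ContinuousAt, h0]
  intro s hs
  obtain ⟨u, hus, hu, hmem⟩ := mem_nhds_iff.1 hs
  have hK := (OnePoint.isOpen_def.1 hu).1 hmem
  obtain ⟨R, hR, hKR⟩ := hK.isBounded.exists_pos_norm_le
  refine mem_map.2 ?_
  filter_upwards [Metric.ball_mem_nhds (0 : ℂ) (inv_pos.2 hR)] with t ht
  refine hus ?_
  by_cases h : t = 0
  · simpa [ofHom, h] using hmem
  · have e : ofHom (1, t) = ((t⁻¹ : ℂ) : P1) := by simp [ofHom, h]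
    change ofHom (1, t) ∈ u
    rw [e]
    by_contra hn
    have h1 := hKR t⁻¹ hn
    rw [mem_ball_zero_iff] at ht
    rw [norm_inv] at h1
    exact absurd h1 (not_le.2 (lt_inv_of_lt_inv₀ (norm_pos_iff.2 h) ht))

theorem continuousAt_chart1Inv (c : P1) : ContinuousAt (chart1Inv c) (chart1 c c) := by
  induction c using OnePoint.rec with
  | infty =>
    have : chart1 ∞ ∞ = 0 := by simp [chart1]
    rw [this]
    exact continuousAt_ofHom_one
  | coe x =>
    have : chart1Inv (x : P1) = ((↑) : ℂ → P1) := by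
      funext t; exact ofHom_coe_one t
    rw [this]
    exact OnePoint.continuous_coe.continuousAt

theorem continuousAt_chartInv {n : ℕ} (c : Fin n → P1) :
    ContinuousAt (chartInv c) (chart c c) :=
  continuousAt_pi.2 fun i =>
    (continuousAt_chart1Inv (c i)).comp (f := fun t : Fin n → ℂ => t i)
      (x := chart c c) (continuous_apply i).continuousAt

/-! ### The two-cycle at infinity and the local form of the map -/

/-- The permutation exchanging the first two and the last two coordinates. -/
def swapPairs : Equiv.Perm (Fin 4) := Equiv.swap 0 1 * Equiv.swap 2 3

theorem coe_swapPairs : (swapPairs : Fin 4 → Fin 4) = ![1, 0, 3, 2] := by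
  funext i
  fin_cases i <;> rfl

theorem comp_swapPairs_swapPairs {X : Type*} (z : Fin 4 → X) :
    (z ∘ swapPairs) ∘ swapPairs = z := by
  funext i
  simp only [Function.comp_apply, coe_swapPairs]
  fin_cases i <;> rfl

/-- A point of the two-cycle. -/
def cyclePt (m c : ℂ) : Fin 4 → P1 := ![∞, (m : ℂ), (m + c : ℂ), (m - c : ℂ)]

/-- The coordinates of `cyclePt m c`. -/
def cycleCoord (m c : ℂ) : Fin 4 → ℂ := ![0, m, m + c, m - c]

theorem chart_cyclePt (m c : ℂ) : chart (cyclePt m c) (cyclePt m c) = cycleCoord m c := by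
  funext i
  fin_cases i <;> simp [chart, cyclePt, cycleCoord, chart1]

theorem chartInv_cyclePt (m c : ℂ) (t : Fin 4 → ℂ) :
    chartInv (cyclePt m c) t = ![ofHom (1, t 0), (t 1 : ℂ), (t 2 : ℂ), (t 3 : ℂ)] := by
  funext i
  fin_cases i
  · simp [chartInv, cyclePt, chart1Inv]
  all_goals exact ofHom_coe_one _

/-- The logarithmic derivative of `qᵢ` at `zᵢ`, where `z₀ = 1 / t₀`, `zⱼ = tⱼ` for `j > 0` and
`{i, j, k} = {1, 2, 3}`. -/
def logD (α : Fin 4 → ℂ) (i j k : Fin 4) (t : Fin 4 → ℂ) : ℂ :=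
  ∑ l, 1 / (t i - α l) - 1 / (t i - t j) - 1 / (t i - t k) + t 0 / (1 - t i * t 0)

/-- The numerator of the new first coordinate. -/
def numInf (α : Fin 4 → ℂ) (t : Fin 4 → ℂ) : ℂ :=
  ∑ l, α l / (1 - t 0 * α l)
    - (t 1 / (1 - t 0 * t 1) + t 2 / (1 - t 0 * t 2) + t 3 / (1 - t 0 * t 3))

/-- The map `JEA`, followed by `swapPairs`, in the coordinates near `cyclePt`. -/
def localMap (α : Fin 4 → ℂ) (t : Fin 4 → ℂ) : Fin 4 → ℂ :=
  ![logD α 1 2 3 t / (t 1 * logD α 1 2 3 t - 1), numInf α t / (1 + t 0 * numInf α t),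
    t 3 - 1 / logD α 3 1 2 t, t 2 - 1 / logD α 2 1 3 t]

/-- The points at which `localMap` represents `JEA`. -/
structure Regular (α : Fin 4 → ℂ) (t : Fin 4 → ℂ) : Prop where
  ne_root : ∀ i, i ≠ 0 → ∀ k, t i - α k ≠ 0
  inf_root : ∀ k, 1 - t 0 * α k ≠ 0
  inf_ne : ∀ i, i ≠ 0 → 1 - t 0 * t i ≠ 0
  ne12 : t 1 - t 2 ≠ 0
  ne13 : t 1 - t 3 ≠ 0
  ne23 : t 2 - t 3 ≠ 0
  den0 : 1 + t 0 * numInf α t ≠ 0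
  den1 : t 1 * logD α 1 2 3 t - 1 ≠ 0
  den2 : logD α 2 1 3 t ≠ 0
  den3 : logD α 3 1 2 t ≠ 0

theorem univ_erase_fin_four :
    (Finset.univ.erase (0 : Fin 4) = {1, 2, 3}) ∧ (Finset.univ.erase (1 : Fin 4) = {0, 2, 3}) ∧
    (Finset.univ.erase (2 : Fin 4) = {0, 1, 3}) ∧ (Finset.univ.erase (3 : Fin 4) = {0, 1, 2}) := by
  decide

section Regular

variable {α : Fin 4 → ℂ} {t : Fin 4 → ℂ}

/-- With z₀ = 1 / t₀, each 1 / (1 − t₀x) equals 1 + t₀x / (1 − t₀x). Four roots against three other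
coordinates leave the constant 1 in the second entry. -/
theorem Regular.stepPair_zero (h : Regular α t) (m c : ℂ) :
    ∃ s : ℂ, s ≠ 0 ∧ stepPair α (chartInv (cyclePt m c) t) 0
      = s • (numInf α t, 1 + t 0 * numInf α t) := by
  obtain ⟨κ, hκ, hh⟩ := exists_hom_ofHom (t 0)
  have hbr : ∀ x : ℂ, br (ofHom (1, t 0)) x = κ * (1 - t 0 * x) := fun x => by
    simp only [br, hh, hom_coe]; ring
  rw [chartInv_cyclePt]
  obtain ⟨s, hs, e⟩ := stepPair_eq_smul α ![ofHom (1, t 0), (t 1 : ℂ), (t 2 : ℂ), (t 3 : ℂ)] 0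
    (fun k => by
      simp only [Matrix.cons_val_zero, hbr]
      exact mul_ne_zero hκ (h.inf_root k))
    (fun j hj => by
      have := h.inf_ne j hj
      fin_cases j
      · exact absurd rfl hj
      all_goals
        simp [hbr, hκ]
        exact this)
  refine ⟨s * κ⁻¹, mul_ne_zero hs (inv_ne_zero hκ), ?_⟩
  rw [e, mul_smul]
  congr 1
  have r0 := h.inf_root 0
  have r1 := h.inf_root 1
  have r2 := h.inf_root 2
  have r3 := h.inf_root 3
  have i1 := h.inf_ne 1 (by decide)
  have i2 := h.inf_ne 2 (by decide)
  have i3 := h.inf_ne 3 (by decide)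
  have aux : ∀ x : ℂ, 1 - t 0 * x ≠ 0 →
      1 / (κ * (1 - t 0 * x)) = κ⁻¹ * (1 + t 0 * (x / (1 - t 0 * x))) := fun x hx => by
    field_simp
    ring
  have aux' : ∀ x : ℂ, x / (κ * (1 - t 0 * x)) = κ⁻¹ * (x / (1 - t 0 * x)) := fun x => by
    rw [div_mul_eq_div_div_swap, div_eq_inv_mul]
  ext
  · simp [univ_erase_fin_four, Fin.sum_univ_four, hbr, numInf, aux']
    ring
  · simp [univ_erase_fin_four, Fin.sum_univ_four, numInf, ← one_div, *]
    ring

/-- Writing x / (tᵢ − x) as tᵢ / (tᵢ − x) − 1 expresses the first entry through the second; the −1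
is again three other coordinates minus four roots. -/
theorem Regular.stepPair_pos (h : Regular α t) (m c : ℂ) {i j k : Fin 4} (hi : i ≠ 0)
    (hj : j ≠ 0) (hk : k ≠ 0) (hjk : j ≠ k) (hij : t i - t j ≠ 0) (hik : t i - t k ≠ 0)
    (he : Finset.univ.erase i = {0, j, k}) :
    ∃ s : ℂ, s ≠ 0 ∧ stepPair α (chartInv (cyclePt m c) t) i
      = s • (t i * logD α i j k t - 1, logD α i j k t) := by
  obtain ⟨κ, hκ, hh⟩ := exists_hom_ofHom (t 0)
  have hz : ∀ i, i ≠ 0 → chartInv (cyclePt m c) t i = (t i : ℂ) := by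
    intro i hi
    rw [chartInv_cyclePt]
    fin_cases i
    · exact absurd rfl hi
    all_goals rfl
  have hz0 : chartInv (cyclePt m c) t 0 = ofHom (1, t 0) := by rw [chartInv_cyclePt]; rfl
  have hbr : br (t i : ℂ) (ofHom (1, t 0)) = - (κ * (1 - t i * t 0)) := by
    simp only [br, hh, hom_coe]; ring
  have h0 : 1 - t i * t 0 ≠ 0 := by rw [mul_comm]; exact h.inf_ne i hi
  obtain ⟨s, hs, e⟩ := stepPair_eq_smul α (chartInv (cyclePt m c) t) i
    (fun k => by
      rw [hz i hi, br_coe]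
      exact h.ne_root i hi k)
    (fun l hl => by
      have : l ∈ Finset.univ.erase i := by simpa using hl
      rw [he] at this
      simp only [Finset.mem_insert, Finset.mem_singleton] at this
      rcases this with rfl | rfl | rfl
      · rw [hz i hi, hz0, hbr]
        exact neg_ne_zero.2 (mul_ne_zero hκ h0)
      · rw [hz i hi, hz _ hj, br_coe]; exact hij
      · rw [hz i hi, hz _ hk, br_coe]; exact hik)
  refine ⟨s, hs, ?_⟩
  rw [e, he, Finset.sum_insert (by simp [hj.symm, hk.symm]), Finset.sum_insert (by simpa using hjk),
    Finset.sum_insert (by simp [hj.symm, hk.symm]), Finset.sum_insert (by simpa using hjk)]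
  simp only [Finset.sum_singleton, hz i hi, hz j hj, hz k hk, hz0, hbr, br_coe, hom_coe, hh]
  congr 1
  have r := h.ne_root i hi
  have aux : ∀ x : ℂ, t i - x ≠ 0 → x / (t i - x) = t i * (1 / (t i - x)) - 1 := fun x hx => by
    field_simp
    ring
  have e0 : κ / -(κ * (1 - t i * t 0)) = - (t i * (t 0 / (1 - t i * t 0))) - 1 := by
    field_simp
    ring
  have e0' : κ * t 0 / -(κ * (1 - t i * t 0)) = - (t 0 / (1 - t i * t 0)) := by
    field_simp
  ext
  · simp only [Fin.sum_univ_four, logD, aux _ (r _), aux _ hij, aux _ hik, e0]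
    ring
  · simp only [Fin.sum_univ_four, logD, e0']
    ring

theorem Regular.stepPair_one (h : Regular α t) (m c : ℂ) :
    ∃ s : ℂ, s ≠ 0 ∧ stepPair α (chartInv (cyclePt m c) t) 1
      = s • (t 1 * logD α 1 2 3 t - 1, logD α 1 2 3 t) :=
  h.stepPair_pos m c (by decide) (by decide) (by decide) (by decide) h.ne12 h.ne13 (by decide)

theorem Regular.stepPair_two (h : Regular α t) (m c : ℂ) :
    ∃ s : ℂ, s ≠ 0 ∧ stepPair α (chartInv (cyclePt m c) t) 2
      = s • (t 2 * logD α 2 1 3 t - 1, logD α 2 1 3 t) :=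
  h.stepPair_pos m c (by decide) (by decide) (by decide) (by decide)
    (by rw [← neg_sub]; exact neg_ne_zero.2 h.ne12) h.ne23 (by decide)

theorem Regular.stepPair_three (h : Regular α t) (m c : ℂ) :
    ∃ s : ℂ, s ≠ 0 ∧ stepPair α (chartInv (cyclePt m c) t) 3
      = s • (t 3 * logD α 3 1 2 t - 1, logD α 3 1 2 t) :=
  h.stepPair_pos m c (by decide) (by decide) (by decide) (by decide)
    (by rw [← neg_sub]; exact neg_ne_zero.2 h.ne13)
    (by rw [← neg_sub]; exact neg_ne_zero.2 h.ne23) (by decide)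

theorem Regular.defined (h : Regular α t) (m c : ℂ) : Defined α (chartInv (cyclePt m c) t) := by
  obtain ⟨s0, h0, e0⟩ := h.stepPair_zero m c
  obtain ⟨s1, h1, e1⟩ := h.stepPair_one m c
  obtain ⟨s2, h2, e2⟩ := h.stepPair_two m c
  obtain ⟨s3, h3, e3⟩ := h.stepPair_three m c
  intro i
  fin_cases i
  · exact e0 ▸ smul_ne_zero h0 fun h' => h.den0 (congrArg Prod.snd h')
  · exact e1 ▸ smul_ne_zero h1 fun h' => h.den1 (congrArg Prod.fst h')
  · exact e2 ▸ smul_ne_zero h2 fun h' => h.den2 (congrArg Prod.snd h')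
  · exact e3 ▸ smul_ne_zero h3 fun h' => h.den3 (congrArg Prod.snd h')

theorem Regular.JEA_eq (h : Regular α t) (m c : ℂ) :
    JEA α (chartInv (cyclePt m c) t) = chartInv (cyclePt m c) (localMap α t) ∘ swapPairs := by
  obtain ⟨s0, h0, e0⟩ := h.stepPair_zero m c
  obtain ⟨s1, h1, e1⟩ := h.stepPair_one m c
  obtain ⟨s2, h2, e2⟩ := h.stepPair_two m c
  obtain ⟨s3, h3, e3⟩ := h.stepPair_three m c
  funext i
  rw [chartInv_cyclePt m c (localMap α t), Function.comp_apply, coe_swapPairs]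
  have hdiv : ∀ a D : ℂ, D ≠ 0 → (a * D - 1) / D = a - 1 / D := fun a D hD => by
    field_simp
  fin_cases i
  · change ofHom (stepPair α _ 0) = _
    rw [e0, ofHom_smul h0, ofHom_of_ne h.den0]; rfl
  · change ofHom (stepPair α _ 1) = _
    rw [e1, ofHom_smul h1, ofHom_eq_one_div h.den1]; rfl
  · change ofHom (stepPair α _ 2) = _
    rw [e2, ofHom_smul h2, ofHom_of_ne h.den2]
    simp only [hdiv _ _ h.den2]; rfl
  · change ofHom (stepPair α _ 3) = _
    rw [e3, ofHom_smul h3, ofHom_of_ne h.den3]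
    simp only [hdiv _ _ h.den3]; rfl

theorem Regular.JEA_swapPairs (h : Regular α t) (m c : ℂ) :
    JEA α (chartInv (cyclePt m c) t ∘ swapPairs) = chartInv (cyclePt m c) (localMap α t) := by
  rw [JEA_comp_perm, h.JEA_eq, comp_swapPairs_swapPairs]

/-- The point of `ℂ⁴` with coordinates `t`, if `t 0 ≠ 0`. -/
def affinePt (t : Fin 4 → ℂ) : Fin 4 → ℂ := ![(t 0)⁻¹, t 1, t 2, t 3]

theorem incl_affinePt (m c : ℂ) (h0 : t 0 ≠ 0) :
    incl (affinePt t) = chartInv (cyclePt m c) t := by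
  rw [chartInv_cyclePt]
  funext i
  fin_cases i
  · simp [incl, affinePt, ofHom, h0]
  all_goals rfl

/-- The two nonvanishing conditions say that the old z₀ and the new z₁ are finite; the other
coordinates are finite by regularity. -/
theorem Regular.isAffineStep (h : Regular α t) (h0 : t 0 ≠ 0) (h1 : localMap α t 0 ≠ 0) :
    IsAffineStep (rootPoly α) (affinePt t) (affinePt (localMap α t) ∘ swapPairs) := by
  have hD1 : logD α 1 2 3 t ≠ 0 := by
    intro h'
    simp [localMap, h'] at h1
  have hinv : ∀ x : ℂ, (t 0)⁻¹ - x = (1 - t 0 * x) / t 0 := fun x => by field_simp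
  have r := h.inf_root
  have i1 := h.inf_ne 1 (by decide)
  have i2 := h.inf_ne 2 (by decide)
  have i3 := h.inf_ne 3 (by decide)
  have hlog : ∀ i, ∑ k, 1 / (affinePt t i - α k)
      - ∑ j ∈ Finset.univ.erase i, 1 / (affinePt t i - affinePt t j)
      = ![t 0 * (1 + t 0 * numInf α t), logD α 1 2 3 t, logD α 2 1 3 t, logD α 3 1 2 t] i := by
    have aux : ∀ x : ℂ, 1 - t 0 * x ≠ 0 →
        1 / ((1 - t 0 * x) / t 0) = t 0 * (1 + t 0 * (x / (1 - t 0 * x))) := fun x hx => by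
      field_simp
      ring
    have aux' : ∀ x : ℂ, 1 - t 0 * x ≠ 0 →
        1 / (x - (t 0)⁻¹) = - (t 0 / (1 - x * t 0)) := fun x hx => by
      rw [← neg_sub, hinv, mul_comm x]
      field_simp
    intro i
    fin_cases i
    · simp only [affinePt, univ_erase_fin_four, Fin.sum_univ_four, numInf, Fin.zero_eta,
        Matrix.cons_val_zero]
      rw [Finset.sum_insert (by decide), Finset.sum_insert (by decide), Finset.sum_singleton]
      simp only [Matrix.cons_val, hinv, aux _ (r _), aux _ i1, aux _ i2, aux _ i3]
      ring
    · simp only [affinePt, univ_erase_fin_four, Fin.sum_univ_four, logD, Fin.mk_one,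
        Matrix.cons_val_one]
      rw [Finset.sum_insert (by decide), Finset.sum_insert (by decide), Finset.sum_singleton]
      simp only [Matrix.cons_val, aux' _ i1]
      ring
    · simp only [affinePt, univ_erase_fin_four, Fin.sum_univ_four, logD, Fin.reduceFinMk,
        Matrix.cons_val]
      rw [Finset.sum_insert (by decide), Finset.sum_insert (by decide), Finset.sum_singleton]
      simp only [Matrix.cons_val, aux' _ i2]
      ring
    · simp only [affinePt, univ_erase_fin_four, Fin.sum_univ_four, logD, Fin.reduceFinMk,
        Matrix.cons_val]
      rw [Finset.sum_insert (by decide), Finset.sum_insert (by decide), Finset.sum_singleton]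
      simp only [Matrix.cons_val, aux' _ i3]
      ring
  have hinv0 : ∀ x : ℂ, 1 - t 0 * x ≠ 0 → (t 0)⁻¹ ≠ x := fun x hx => by
    rw [← sub_ne_zero, hinv]
    exact div_ne_zero hx h0
  have n12 := sub_ne_zero.1 h.ne12
  have n13 := sub_ne_zero.1 h.ne13
  have n23 := sub_ne_zero.1 h.ne23
  refine isAffineStep_of_logDeriv ?_ ?_ ?_ ?_
  · intro i k
    fin_cases i
    · exact hinv0 _ (r k)
    · exact sub_ne_zero.1 (h.ne_root 1 (by decide) k)
    · exact sub_ne_zero.1 (h.ne_root 2 (by decide) k)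
    · exact sub_ne_zero.1 (h.ne_root 3 (by decide) k)
  · intro i j hij
    fin_cases i <;> fin_cases j <;> first
      | exact absurd rfl hij
      | exact hinv0 _ i1
      | exact hinv0 _ i2
      | exact hinv0 _ i3
      | exact (hinv0 _ i1).symm
      | exact (hinv0 _ i2).symm
      | exact (hinv0 _ i3).symm
      | exact n12
      | exact n13
      | exact n23
      | exact n12.symm
      | exact n13.symm
      | exact n23.symm
  · intro i
    rw [hlog]
    fin_cases i
    · exact mul_ne_zero h0 h.den0
    · exact hD1
    · exact h.den2
    · exact h.den3
  · intro i
    rw [hlog, Function.comp_apply, coe_swapPairs]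
    have d0 := h.den0
    have d1 := h.den1
    fin_cases i
    · simp only [affinePt, localMap, Fin.zero_eta, Matrix.cons_val]
      rw [← mul_div_mul_left (numInf α t) _ h0, eq_sub_iff_add_eq, ← add_div, add_comm,
        div_mul_cancel_right₀ d0]
    · simp only [affinePt, localMap, Fin.mk_one, Matrix.cons_val]
      field_simp
    · rfl
    · rfl

end Regular

/-! ### Regularity and derivative of the local map -/

section Derivative

variable {α : Fin 4 → ℂ} {t : Fin 4 → ℂ}

theorem contDiffAt_logD {i j k : Fin 4} (hα : ∀ l, t i - α l ≠ 0) (hij : t i - t j ≠ 0)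
    (hik : t i - t k ≠ 0) (h0 : 1 - t i * t 0 ≠ 0) : ContDiffAt ℂ 1 (logD α i j k) t := by
  unfold logD
  refine ContDiffAt.add (ContDiffAt.sub (ContDiffAt.sub (ContDiffAt.sum fun l _ => ?_) ?_) ?_) ?_
  · exact ContDiffAt.div (by fun_prop) (by fun_prop) (hα l)
  · exact ContDiffAt.div (by fun_prop) (by fun_prop) hij
  · exact ContDiffAt.div (by fun_prop) (by fun_prop) hik
  · exact ContDiffAt.div (by fun_prop) (by fun_prop) h0

namespace Regular

theorem contDiffAt_logD_one (h : Regular α t) : ContDiffAt ℂ 1 (logD α 1 2 3) t :=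
  contDiffAt_logD (h.ne_root 1 (by decide)) h.ne12 h.ne13
    (by rw [mul_comm]; exact h.inf_ne 1 (by decide))

theorem contDiffAt_logD_two (h : Regular α t) : ContDiffAt ℂ 1 (logD α 2 1 3) t :=
  contDiffAt_logD (h.ne_root 2 (by decide)) (by rw [← neg_sub]; exact neg_ne_zero.2 h.ne12)
    h.ne23 (by rw [mul_comm]; exact h.inf_ne 2 (by decide))

theorem contDiffAt_logD_three (h : Regular α t) : ContDiffAt ℂ 1 (logD α 3 1 2) t :=
  contDiffAt_logD (h.ne_root 3 (by decide)) (by rw [← neg_sub]; exact neg_ne_zero.2 h.ne13)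
    (by rw [← neg_sub]; exact neg_ne_zero.2 h.ne23)
    (by rw [mul_comm]; exact h.inf_ne 3 (by decide))

theorem contDiffAt_numInf (h : Regular α t) : ContDiffAt ℂ 1 (numInf α) t := by
  unfold numInf
  refine ContDiffAt.sub (ContDiffAt.sum fun l _ => ?_)
    (ContDiffAt.add (ContDiffAt.add ?_ ?_) ?_)
  · exact ContDiffAt.div (by fun_prop) (by fun_prop) (h.inf_root l)
  · exact ContDiffAt.div (by fun_prop) (by fun_prop) (h.inf_ne 1 (by decide))
  · exact ContDiffAt.div (by fun_prop) (by fun_prop) (h.inf_ne 2 (by decide))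
  · exact ContDiffAt.div (by fun_prop) (by fun_prop) (h.inf_ne 3 (by decide))

theorem contDiffAt_localMap (h : Regular α t) : ContDiffAt ℂ 1 (localMap α) t := by
  have h1 := h.contDiffAt_logD_one
  have h2 := h.contDiffAt_logD_two
  have h3 := h.contDiffAt_logD_three
  have hK := h.contDiffAt_numInf
  rw [contDiffAt_pi]
  intro i
  fin_cases i
  · exact ContDiffAt.div h1 (by fun_prop) h.den1
  · exact ContDiffAt.div hK (by fun_prop) h.den0
  · exact ContDiffAt.sub (by fun_prop) (ContDiffAt.div (by fun_prop) h3 h.den3)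
  · exact ContDiffAt.sub (by fun_prop) (ContDiffAt.div (by fun_prop) h2 h.den2)

theorem eventually (h : Regular α t) : ∀ᶠ s in 𝓝 t, Regular α s := by
  have h1 := h.contDiffAt_logD_one.continuousAt
  have h2 := h.contDiffAt_logD_two.continuousAt
  have h3 := h.contDiffAt_logD_three.continuousAt
  have hK := h.contDiffAt_numInf.continuousAt
  have e1 : ∀ᶠ s in 𝓝 t, ∀ i, i ≠ 0 → ∀ k, s i - α k ≠ 0 := by
    simp only [eventually_all]
    intro i hi k
    exact ContinuousAt.eventually_ne (g := fun s : Fin 4 → ℂ => s i - α k)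
      ((continuous_apply i).sub continuous_const).continuousAt
      (h.ne_root i hi k)
  have e2 : ∀ᶠ s in 𝓝 t, ∀ k, 1 - s 0 * α k ≠ 0 := by
    simp only [eventually_all]
    intro k
    exact ContinuousAt.eventually_ne (g := fun s : Fin 4 → ℂ => 1 - s 0 * α k)
      (continuous_const.sub ((continuous_apply 0).mul continuous_const)).continuousAt
      (h.inf_root k)
  have e3 : ∀ᶠ s in 𝓝 t, ∀ i, i ≠ 0 → 1 - s 0 * s i ≠ 0 := by
    simp only [eventually_all]
    intro i hi
    exact ContinuousAt.eventually_ne (g := fun s : Fin 4 → ℂ => 1 - s 0 * s i) (by fun_prop)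
      (h.inf_ne i hi)
  filter_upwards [e1, e2, e3,
    ContinuousAt.eventually_ne (g := fun s : Fin 4 → ℂ => s 1 - s 2) (by fun_prop) h.ne12,
    ContinuousAt.eventually_ne (g := fun s : Fin 4 → ℂ => s 1 - s 3) (by fun_prop) h.ne13,
    ContinuousAt.eventually_ne (g := fun s : Fin 4 → ℂ => s 2 - s 3) (by fun_prop) h.ne23,
    ContinuousAt.eventually_ne (g := fun s => 1 + s 0 * numInf α s)
      (continuousAt_const.add ((continuous_apply 0).continuousAt.mul hK)) h.den0,
    ContinuousAt.eventually_ne (g := fun s => s 1 * logD α 1 2 3 s - 1)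
      (((continuous_apply 1).continuousAt.mul h1).sub continuousAt_const) h.den1,
    h2.eventually_ne h.den2, h3.eventually_ne h.den3] with s a1 a2 a3 a4 a5 a6 a7 a8 a9 a10
  exact ⟨a1, a2, a3, a4, a5, a6, a7, a8, a9, a10⟩

end Regular

theorem hasDerivAt_one_div {f : ℂ → ℂ} {f' x : ℂ} (hf : HasDerivAt f f' x) (h0 : f x ≠ 0) :
    HasDerivAt (fun s => 1 / f s) (-f' / f x ^ 2) x := by
  simpa only [one_div] using hf.fun_inv h0

theorem hasDerivAt_line (t h : Fin 4 → ℂ) (i : Fin 4) :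
    HasDerivAt (fun s : ℂ => (t + s • h) i) (h i) 0 := by
  simpa using ((hasDerivAt_id (0 : ℂ)).mul_const (h i)).const_add (t i)

theorem hasDerivAt_logD (h : Fin 4 → ℂ) {i j k : Fin 4} (hα : ∀ l, t i - α l ≠ 0)
    (hij : t i - t j ≠ 0) (hik : t i - t k ≠ 0) (h0 : t 0 = 0) :
    HasDerivAt (fun s : ℂ => logD α i j k (t + s • h))
      (∑ l, -h i / (t i - α l) ^ 2 - -(h i - h j) / (t i - t j) ^ 2
        - -(h i - h k) / (t i - t k) ^ 2 + h 0) 0 := by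
  have e : ∀ i, (t + (0 : ℂ) • h) i = t i := fun i => by simp
  have hi := hasDerivAt_line t h i
  have hj := hasDerivAt_line t h j
  have hk := hasDerivAt_line t h k
  have h00 := hasDerivAt_line t h 0
  have d1 := hasDerivAt_one_div (hi.fun_sub hj) (by rwa [e, e])
  have d2 := hasDerivAt_one_div (hi.fun_sub hk) (by rwa [e, e])
  have d3 := h00.fun_div ((hi.fun_mul h00).const_sub 1) (by simp [h0])
  have d0 := HasDerivAt.fun_sum (u := Finset.univ) fun l _ =>
    hasDerivAt_one_div (hi.sub_const (α l)) (by rw [e]; exact hα l)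
  refine (((d0.fun_sub d1).fun_sub d2).fun_add d3).congr_deriv ?_
  simp [h0]

theorem hasDerivAt_numInf (h : Fin 4 → ℂ) (h0 : t 0 = 0) :
    HasDerivAt (fun s : ℂ => numInf α (t + s • h))
      (h 0 * (∑ l, α l ^ 2 - (t 1 ^ 2 + t 2 ^ 2 + t 3 ^ 2)) - (h 1 + h 2 + h 3)) 0 := by
  have h00 := hasDerivAt_line t h 0
  have d : ∀ i, HasDerivAt (fun s : ℂ => (t + s • h) i / (1 - (t + s • h) 0 * (t + s • h) i))
      (h i + h 0 * t i ^ 2) 0 := fun i => by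
    have hi := hasDerivAt_line t h i
    refine (hi.fun_div ((h00.fun_mul hi).const_sub 1) (by simp [h0])).congr_deriv ?_
    simp [h0]
    ring
  have d0 := HasDerivAt.fun_sum (u := Finset.univ) fun l (_ : l ∈ Finset.univ) =>
    (hasDerivAt_const (0 : ℂ) (α l)).fun_div ((h00.mul_const (α l)).const_sub 1) (by simp [h0])
  refine (d0.fun_sub (((d 1).fun_add (d 2)).fun_add (d 3))).congr_deriv ?_
  simp [h0, Fin.sum_univ_four]
  ring

end Derivative

/-! ### ### The fixed point and its derivative for a parallelogram -/

/-- The vertices of the parallelogram with center `m` and half diagonals `a`, `b`. -/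
def vertices (m a b : ℂ) : Fin 4 → ℂ := ![m + a, m + b, m - a, m - b]

section Vertices

variable {m a b c : ℂ}

theorem logD_one_cycleCoord (m a b c : ℂ) :
    logD (vertices m a b) 1 2 3 (cycleCoord m c) = 0 := by
  simp [logD, vertices, cycleCoord, Fin.sum_univ_four]

theorem numInf_cycleCoord (m a b c : ℂ) :
    numInf (vertices m a b) (cycleCoord m c) = m := by
  simp [numInf, vertices, cycleCoord, Fin.sum_univ_four]
  ring

theorem sq_ne_of_sq_eq_mul (ha : a ≠ 0) (hab : a ≠ b) (hc : c ^ 2 = a * b) :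
    c - a ≠ 0 ∧ c + a ≠ 0 := by
  refine ⟨fun h => ?_, fun h => ?_⟩
  · rw [sub_eq_zero.1 h, sq] at hc
    exact hab (mul_left_cancel₀ ha hc)
  · rw [eq_neg_of_add_eq_zero_left h, neg_sq, sq] at hc
    exact hab (mul_left_cancel₀ ha hc)

/-- This is p'/p at m + c. With c² = ab the terms 2c/(c² − a²) and 2c/(c² − b²) add up to 2c/(ab);
this is what singles out c² = ab. -/
theorem sum_inv_sub (ha : a ≠ 0) (hb : b ≠ 0) (hab : a ≠ b) (hc : c ^ 2 = a * b) (hc0 : c ≠ 0) :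
    1 / (c - a) + 1 / (c - b) + 1 / (c + a) + 1 / (c + b) = 2 / c := by
  obtain ⟨h1, h2⟩ := sq_ne_of_sq_eq_mul ha hab hc
  obtain ⟨h3, h4⟩ := sq_ne_of_sq_eq_mul hb hab.symm (hc.trans (mul_comm a b))
  field_simp
  have : c ^ 4 = (a * b) ^ 2 := by rw [← hc]; ring
  linear_combination 2 * this

/-- Opposite vertices are paired; c² = ab then factors c² − a² as −a(a − b) and c² − b² as b(a − b).
-/
theorem sum_inv_sub_sq (ha : a ≠ 0) (hb : b ≠ 0) (hab : a ≠ b) (hc : c ^ 2 = a * b) :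
    c ^ 2 * (1 / (c - a) ^ 2 + 1 / (c - b) ^ 2 + 1 / (c + a) ^ 2 + 1 / (c + b) ^ 2)
      = 2 + 8 * c ^ 2 / (a - b) ^ 2 := by
  obtain ⟨h1, h2⟩ := sq_ne_of_sq_eq_mul ha hab hc
  obtain ⟨h3, h4⟩ := sq_ne_of_sq_eq_mul hb hab.symm (hc.trans (mul_comm a b))
  have h5 := sub_ne_zero.2 hab
  have e1 : 1 / (c - a) ^ 2 + 1 / (c + a) ^ 2 = 2 * (a + b) / (a * (a - b) ^ 2) := by
    have : 1 / (c - a) ^ 2 + 1 / (c + a) ^ 2 = 2 * (c ^ 2 + a ^ 2) / (c ^ 2 - a ^ 2) ^ 2 := by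
      rw [show c ^ 2 - a ^ 2 = (c - a) * (c + a) by ring]
      field_simp
      ring
    rw [this, hc, show a * b - a ^ 2 = -(a * (a - b)) by ring]
    field_simp
    ring
  have e2 : 1 / (c - b) ^ 2 + 1 / (c + b) ^ 2 = 2 * (a + b) / (b * (a - b) ^ 2) := by
    have : 1 / (c - b) ^ 2 + 1 / (c + b) ^ 2 = 2 * (c ^ 2 + b ^ 2) / (c ^ 2 - b ^ 2) ^ 2 := by
      rw [show c ^ 2 - b ^ 2 = (c - b) * (c + b) by ring]
      field_simp
      ring
    rw [this, hc, show a * b - b ^ 2 = b * (a - b) by ring]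
    field_simp
  calc _ = c ^ 2 * ((1 / (c - a) ^ 2 + 1 / (c + a) ^ 2)
        + (1 / (c - b) ^ 2 + 1 / (c + b) ^ 2)) := by ring
    _ = _ := by
      rw [e1, e2, hc]
      field_simp
      ring

theorem logD_two_cycleCoord (ha : a ≠ 0) (hb : b ≠ 0) (hab : a ≠ b) (hc : c ^ 2 = a * b)
    (hc0 : c ≠ 0) : logD (vertices m a b) 2 1 3 (cycleCoord m c) = 1 / (2 * c) := by
  have h := sum_inv_sub ha hb hab hc hc0
  have e : logD (vertices m a b) 2 1 3 (cycleCoord m c)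
      = 1 / (c - a) + 1 / (c - b) + 1 / (c + a) + 1 / (c + b) - 1 / c - 1 / (2 * c) := by
    simp [logD, vertices, cycleCoord, Fin.sum_univ_four, ← two_mul]
  rw [e, h]
  field_simp
  ring

theorem logD_three_cycleCoord (ha : a ≠ 0) (hb : b ≠ 0) (hab : a ≠ b) (hc : c ^ 2 = a * b)
    (hc0 : c ≠ 0) : logD (vertices m a b) 3 1 2 (cycleCoord m c) = -(1 / (2 * c)) := by
  have h := sum_inv_sub ha hb hab hc hc0
  have e : logD (vertices m a b) 3 1 2 (cycleCoord m c)
      = -(1 / (c - a) + 1 / (c - b) + 1 / (c + a) + 1 / (c + b)) + 1 / c + 1 / (2 * c) := by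
    simp only [logD, vertices, cycleCoord, Fin.sum_univ_four, Matrix.cons_val]
    rw [show m - c - (m + a) = -(c + a) by ring, show m - c - (m + b) = -(c + b) by ring,
      show m - c - (m - a) = -(c - a) by ring, show m - c - (m - b) = -(c - b) by ring,
      show m - c - m = -c by ring, show m - c - (m + c) = -(2 * c) by ring]
    simp only [div_neg]
    ring
  rw [e, h]
  field_simp
  ring

theorem regular_cycleCoord (ha : a ≠ 0) (hb : b ≠ 0) (hab : a ≠ b) (hc : c ^ 2 = a * b)
    (hc0 : c ≠ 0) : Regular (vertices m a b) (cycleCoord m c) := by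
  obtain ⟨h1, h2⟩ := sq_ne_of_sq_eq_mul ha hab hc
  obtain ⟨h3, h4⟩ := sq_ne_of_sq_eq_mul hb hab.symm (hc.trans (mul_comm a b))
  have h1' : -c + a ≠ 0 := by rw [show -c + a = -(c - a) by ring]; exact neg_ne_zero.2 h1
  have h2' : -c - a ≠ 0 := by rw [show -c - a = -(c + a) by ring]; exact neg_ne_zero.2 h2
  have h3' : -c + b ≠ 0 := by rw [show -c + b = -(c - b) by ring]; exact neg_ne_zero.2 h3
  have h4' : -c - b ≠ 0 := by rw [show -c - b = -(c + b) by ring]; exact neg_ne_zero.2 h4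
  have hcc : -c - c ≠ 0 := by
    rw [show -c - c = -(2 * c) by ring]; exact neg_ne_zero.2 (mul_ne_zero two_ne_zero hc0)
  refine ⟨?_, ?_, ?_, ?_, ?_, ?_, ?_, ?_, ?_, ?_⟩
  · intro i hi k
    fin_cases i
    · exact absurd rfl hi
    · fin_cases k <;> simp [vertices, cycleCoord, ha, hb]
    · fin_cases k
      · simpa [vertices, cycleCoord] using h1
      · simpa [vertices, cycleCoord] using h3
      · simpa [vertices, cycleCoord] using h2
      · simpa [vertices, cycleCoord] using h4
    · fin_cases k
      · change m - c - (m + a) ≠ 0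
        rw [show m - c - (m + a) = -c - a by ring]; exact h2'
      · change m - c - (m + b) ≠ 0
        rw [show m - c - (m + b) = -c - b by ring]; exact h4'
      · change m - c - (m - a) ≠ 0
        rw [show m - c - (m - a) = -c + a by ring]; exact h1'
      · change m - c - (m - b) ≠ 0
        rw [show m - c - (m - b) = -c + b by ring]; exact h3'
  · intro k; simp [cycleCoord]
  · intro k hk; simp [cycleCoord]
  · simpa [cycleCoord] using hc0
  · simpa [cycleCoord] using hc0
  · change m + c - (m - c) ≠ 0
    rw [show m + c - (m - c) = -(-c - c) by ring]
    exact neg_ne_zero.2 hcc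
  · simp [cycleCoord]
  · simp [logD_one_cycleCoord]
  · rw [logD_two_cycleCoord ha hb hab hc hc0]
    exact one_div_ne_zero (mul_ne_zero two_ne_zero hc0)
  · rw [logD_three_cycleCoord ha hb hab hc hc0]
    exact neg_ne_zero.2 (one_div_ne_zero (mul_ne_zero two_ne_zero hc0))

theorem localMap_cycleCoord (ha : a ≠ 0) (hb : b ≠ 0) (hab : a ≠ b) (hc : c ^ 2 = a * b)
    (hc0 : c ≠ 0) : localMap (vertices m a b) (cycleCoord m c) = cycleCoord m c := by
  rw [localMap, logD_one_cycleCoord, numInf_cycleCoord, logD_two_cycleCoord ha hb hab hc hc0,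
    logD_three_cycleCoord ha hb hab hc hc0]
  funext i
  fin_cases i
  · simp [cycleCoord]
  · simp [cycleCoord]
  · simp [cycleCoord]; ring
  · simp [cycleCoord]; ring

/-- The derivative of the local map at the fixed point, where `w = -2 (a - b)² / c²`. -/
def linPart (c w : ℂ) (h : Fin 4 → ℂ) : Fin 4 → ℂ :=
  ![(2 - w) / c ^ 2 * h 1 + (h 2 + h 3) / c ^ 2 - h 0,
    (2 - w) * c ^ 2 * h 0 - (h 1 + h 2 + h 3),
    (64 / w - 2) * h 3 - h 2 + 4 * c ^ 2 * h 0 - 4 * h 1,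
    (64 / w - 2) * h 2 - h 3 + 4 * c ^ 2 * h 0 - 4 * h 1]

/-- Each component is differentiated along the line s ↦ t + s h. The sums of inverse squares that
appear are (4 − w)/c² at m and (2 − 16/w)/c² at m ± c. -/
theorem fderiv_localMap_cycleCoord {w : ℂ} (ha : a ≠ 0) (hb : b ≠ 0) (hab : a ≠ b)
    (hc : c ^ 2 = a * b) (hc0 : c ≠ 0) (hw : w = -2 * (a - b) ^ 2 / c ^ 2) (h : Fin 4 → ℂ) :
    fderiv ℂ (localMap (vertices m a b)) (cycleCoord m c) h = linPart c w h := by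
  have R := regular_cycleCoord (m := m) ha hb hab hc hc0
  set α := vertices m a b with hα
  set t := cycleCoord m c with ht
  have t0 : t 0 = 0 := rfl
  have t1 : t 1 = m := rfl
  have t2 : t 2 = m + c := rfl
  have t3 : t 3 = m - c := rfl
  have et : t + (0 : ℂ) • h = t := by simp
  have hline : HasDerivAt (fun s : ℂ => t + s • h) h 0 := by
    rw [hasDerivAt_pi]; exact hasDerivAt_line t h
  have hG : HasFDerivAt (localMap α) (fderiv ℂ (localMap α) t) (t + (0 : ℂ) • h) := by
    rw [et]; exact (R.contDiffAt_localMap.differentiableAt one_ne_zero).hasFDerivAt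
  have hL := hasDerivAt_pi.1 (hG.comp_hasDerivAt (0 : ℂ) hline)
  have D1 := hasDerivAt_logD h (R.ne_root 1 (by decide)) R.ne12 R.ne13 t0
  have D2 := hasDerivAt_logD h (R.ne_root 2 (by decide))
    (by rw [← neg_sub]; exact neg_ne_zero.2 R.ne12) R.ne23 t0
  have D3 := hasDerivAt_logD h (R.ne_root 3 (by decide))
    (by rw [← neg_sub]; exact neg_ne_zero.2 R.ne13)
    (by rw [← neg_sub]; exact neg_ne_zero.2 R.ne23) t0
  have DK := hasDerivAt_numInf (α := α) h t0
  have l1 : logD α 1 2 3 t = 0 := logD_one_cycleCoord m a b c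
  have l2 : logD α 2 1 3 t = 1 / (2 * c) := logD_two_cycleCoord ha hb hab hc hc0
  have l3 : logD α 3 1 2 t = -(1 / (2 * c)) := logD_three_cycleCoord ha hb hab hc hc0
  have lK : numInf α t = m := numInf_cycleCoord m a b c
  have hS := sum_inv_sub_sq ha hb hab hc
  have hab' := sub_ne_zero.2 hab
  have hw64 : 64 / w = -32 * c ^ 2 / (a - b) ^ 2 := by
    rw [hw]; field_simp; norm_num
  have hww : w * c ^ 2 = -2 * (a - b) ^ 2 := by rw [hw]; field_simp
  have sum2 : ∀ x : ℂ, ∑ l, -x / (t 2 - α l) ^ 2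
      = -x * (1 / (c - a) ^ 2 + 1 / (c - b) ^ 2 + 1 / (c + a) ^ 2 + 1 / (c + b) ^ 2) := by
    intro x
    simp [Fin.sum_univ_four, t2, hα, vertices]
    ring
  have sum3 : ∀ x : ℂ, ∑ l, -x / (t 3 - α l) ^ 2
      = -x * (1 / (c - a) ^ 2 + 1 / (c - b) ^ 2 + 1 / (c + a) ^ 2 + 1 / (c + b) ^ 2) := by
    intro x
    rw [← neg_sq (c - a), ← neg_sq (c - b), ← neg_sq (c + a), ← neg_sq (c + b)]
    simp only [Fin.sum_univ_four, t3, hα, vertices, Matrix.cons_val]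
    rw [show m - c - (m + a) = -(c + a) by ring, show m - c - (m + b) = -(c + b) by ring,
      show m - c - (m - a) = -(c - a) by ring, show m - c - (m - b) = -(c - b) by ring]
    ring
  set S := 1 / (c - a) ^ 2 + 1 / (c - b) ^ 2 + 1 / (c + a) ^ 2 + 1 / (c + b) ^ 2
  have hSw : c ^ 2 * S = 2 - 64 / w / 4 := by rw [hS, hw64]; ring
  funext i
  fin_cases i
  · refine (hL 0).unique ((D1.fun_div (((hasDerivAt_line t h 1).fun_mul D1).sub_const 1)
      (by rw [et]; exact R.den1)).congr_deriv ?_)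
    rw [et, l1]
    have : ∑ l, -h 1 / (t 1 - α l) ^ 2 = -(h 1 * ((4 - w) / c ^ 2)) := by
      have e4 : (4 - w) / c ^ 2 = 2 * (1 / a ^ 2 + 1 / b ^ 2) := by
        rw [div_eq_iff (pow_ne_zero 2 hc0)]
        have : (4 - w) * c ^ 2 = 4 * (a * b) + 2 * (a - b) ^ 2 := by
          rw [sub_mul, hww, hc]; ring
        have h4 : 2 * (1 / a ^ 2 + 1 / b ^ 2) * c ^ 2 * c ^ 2 = (4 - w) * c ^ 2 := by
          rw [this, hc]; field_simp; ring
        exact (mul_right_cancel₀ (pow_ne_zero 2 hc0) h4).symm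
      rw [e4]
      simp [Fin.sum_univ_four, t1, hα, vertices]
      ring
    rw [this]
    simp [t1, t2, t3, linPart]
    ring
  · refine (hL 1).unique ((DK.fun_div (((hasDerivAt_line t h 0).fun_mul DK).const_add 1)
      (by rw [et]; exact R.den0)).congr_deriv ?_)
    rw [et, lK]
    simp [t0, t1, t2, t3, linPart, Fin.sum_univ_four, hα, vertices]
    linear_combination h 0 * hww - 4 * h 0 * hc
  · refine (hL 2).unique (((hasDerivAt_line t h 3).fun_sub (hasDerivAt_one_div D3
      (by rw [et]; exact R.den3))).congr_deriv ?_)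
    rw [et, l3, sum3]
    simp only [t1, t2, t3, linPart, Matrix.cons_val, Fin.reduceFinMk]
    rw [show m - c - m = -c by ring, show m - c - (m + c) = -(2 * c) by ring]
    field_simp
    linear_combination (-4 * h 3) * hSw
  · refine (hL 3).unique (((hasDerivAt_line t h 2).fun_sub (hasDerivAt_one_div D2
      (by rw [et]; exact R.den2))).congr_deriv ?_)
    rw [et, l2, sum2]
    simp only [t1, t2, t3, linPart, Matrix.cons_val, Fin.reduceFinMk]
    rw [show m + c - m = c by ring, show m + c - (m - c) = 2 * c by ring]
    field_simp
    linear_combination (-4 * h 2) * hSw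

end Vertices

/-! ### Eigenvalues and eigenvectors -/

theorem exists_eigenvalue {w : ℂ} (hw : ‖w - 4‖ < 1 / 100) :
    ∃ e₁ e₂ : ℂ, e₁ * e₂ = 48 ∧ e₁ + e₂ = w + 64 / w ∧ ‖e₁ - 3‖ < 1 ∧ e₁ ≠ 3 := by
  have hwn : 3.99 ≤ ‖w‖ := by
    have := norm_sub_norm_le (4 : ℂ) w
    rw [norm_sub_rev 4 w] at this
    norm_num at this ⊢
    linarith
  have hw0 : w ≠ 0 := norm_pos_iff.1 (by linarith)
  set W : ℂ := w + 64 / w with hWdef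
  have hW : ‖W - 20‖ < 6 / 100 := by
    -- The value at w = 4 is 20, and 64/w − 16 = −16(w − 4)/w.
    have e : W - 20 = (w - 4) + -(16 * (w - 4) / w) := by
      rw [hWdef]; field_simp; ring
    have h1 : ‖16 * (w - 4) / w‖ ≤ 0.16 / 3.99 := by
      rw [norm_div, norm_mul]
      refine div_le_div₀ (by norm_num) ?_ (by norm_num) hwn
      norm_num at hw ⊢
      linarith
    rw [e]
    refine (norm_add_le _ _).trans_lt ?_
    rw [norm_neg]
    norm_num at h1 ⊢
    linarith
  obtain ⟨D, hD⟩ := IsAlgClosed.exists_pow_nat_eq (W ^ 2 - 192) (n := 2) (by norm_num)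
  -- The number 14/5 approximates the small root 10 − √52 of e² − 20e + 48. A root equal to 3 would
  -- make the other one 16 and the sum 19, too far from 20.
  have key : ∀ e₁ e₂ : ℂ, e₁ * e₂ = 48 → e₁ + e₂ = W → ‖e₁ - 14 / 5‖ < 3 / 5 →
      ∃ e₁ e₂ : ℂ, e₁ * e₂ = 48 ∧ e₁ + e₂ = W ∧ ‖e₁ - 3‖ < 1 ∧ e₁ ≠ 3 := by
    intro e₁ e₂ h1 h2 h3
    refine ⟨e₁, e₂, h1, h2, ?_, ?_⟩
    · have e : e₁ - 3 = (e₁ - 14 / 5) + (-(1 / 5)) := by ring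
      rw [e]
      refine (norm_add_le _ _).trans_lt ?_
      norm_num at h3 ⊢
      linarith
    · rintro rfl
      have h4 : e₂ = 16 := by linear_combination h1 / 3
      rw [← h2, h4] at hW
      norm_num at hW
  have hprod : (W + D) / 2 * ((W - D) / 2) = 48 := by linear_combination -hD / 4
  have hle : ‖(W + D) / 2 - 14 / 5‖ * ‖(W - D) / 2 - 14 / 5‖ < 36 / 100 := by
    -- The product of the two distances to 14/5 is the modulus of the quadratic at 14/5, which is
    -- below (3/5)²; hence one root is within 3/5.
    rw [← norm_mul]
    have e : ((W + D) / 2 - 14 / 5) * ((W - D) / 2 - 14 / 5)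
        = -(4 / 25) + -(14 / 5 * (W - 20)) := by linear_combination hprod
    rw [e]
    refine (norm_add_le _ _).trans_lt ?_
    rw [norm_neg, norm_neg, norm_mul]
    norm_num at hW ⊢
    linarith
  by_cases h : ‖(W + D) / 2 - 14 / 5‖ < 3 / 5
  · exact key _ _ hprod (by ring) h
  · refine key ((W - D) / 2) ((W + D) / 2) (by rw [mul_comm]; exact hprod) (by ring) ?_
    by_contra h'
    rw [not_lt] at h h'
    nlinarith

/-- The linear coordinates given by a basis of eigenvectors of `linPart c w`. -/
def eigenEquiv (c w e₁ e₂ : ℂ) (hc : c ≠ 0) (he : e₁ ≠ e₂) :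
    (ℂ × (Fin 3 → ℂ)) ≃ₗ[ℂ] (Fin 4 → ℂ) where
  toFun p := ![(p.1 + p.2 0 / 4 + p.2 2 / 4) / c, c * (-p.1 + p.2 0 / 4 - p.2 2 / 4),
    c * ((e₁ - w) / 2 * p.1 + p.2 1 + (e₂ - w) / 2 * (p.2 2 / 4)),
    c * ((e₁ - w) / 2 * p.1 - p.2 1 + (e₂ - w) / 2 * (p.2 2 / 4))]
  map_add' p q := by
    funext i
    fin_cases i <;> simp <;> ring
  map_smul' s p := by
    funext i
    fin_cases i <;> simp <;> ring
  invFun t := (((e₂ - w) * (c * t 0 - t 1 / c) / 2 - (t 2 + t 3) / c) / (e₂ - e₁),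
    ![2 * (c * t 0 + t 1 / c), (t 2 - t 3) / (2 * c),
      4 * ((t 2 + t 3) / c - (e₁ - w) * (c * t 0 - t 1 / c) / 2) / (e₂ - e₁)])
  left_inv p := by
    have he' := sub_ne_zero.2 he.symm
    refine Prod.ext ?_ (funext fun i => ?_)
    · simp
      field_simp
      ring
    · fin_cases i
      · simp
        field_simp
        ring
      · simp
        field_simp
        ring
      · simp
        field_simp
        ring
  right_inv t := by
    have he' := sub_ne_zero.2 he.symm
    funext i
    fin_cases i
    · simp
      field_simp
      ring
    · simp
      field_simp
      ring
    · simp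
      field_simp
      ring
    · simp
      field_simp
      ring

/-- The diagonal map of `ℂ³` with eigenvalues `μ`. -/
def diagMap (μ : Fin 3 → ℂ) : (Fin 3 → ℂ) →L[ℂ] (Fin 3 → ℂ) :=
  ContinuousLinearMap.pi fun i => μ i • ContinuousLinearMap.proj i

@[simp] theorem diagMap_apply (μ y : Fin 3 → ℂ) (i : Fin 3) : diagMap μ y i = μ i * y i := rfl

theorem norm_diagMap_le {μ : Fin 3 → ℂ} {K : ℝ} (hK : 0 ≤ K) (h : ∀ i, ‖μ i‖ ≤ K) :
    ‖diagMap μ‖ ≤ K := by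
  refine ContinuousLinearMap.opNorm_le_bound _ hK fun y => ?_
  refine (pi_norm_le_iff_of_nonneg (by positivity)).2 fun i => ?_
  rw [diagMap_apply, norm_mul]
  exact mul_le_mul (h i) (norm_le_pi_norm y i) (norm_nonneg _) hK

/-- The expanding eigenvalues. -/
def expandingEigenvalues (w e₂ : ℂ) : Fin 3 → ℂ := ![1 - w, 1 - 64 / w, e₂ - 3]

/-- The difference of the last two coordinates splits off with eigenvalue 1 − 64/w, and (1/c, c, 0,
0) is an eigenvector for 1 − w. On the vectors (1/c, −c, cs, cs) with s = (e − w)/2, the eigenvalue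
equation for e − 3 becomes (e − w)(e − 64/w) = 16. -/
theorem linPart_eigenEquiv {c w e₁ e₂ : ℂ} (hc : c ≠ 0) (he : e₁ ≠ e₂) (hw : w ≠ 0)
    (hprod : e₁ * e₂ = 48) (hsum : e₁ + e₂ = w + 64 / w) (p : ℂ × (Fin 3 → ℂ)) :
    linPart c w (eigenEquiv c w e₁ e₂ hc he p)
      = eigenEquiv c w e₁ e₂ hc he
          ((e₁ - 3) * p.1, diagMap (expandingEigenvalues w e₂) p.2) := by
  have h64 : 64 / w = e₁ + e₂ - w := by rw [hsum]; ring
  have hww : w ^ 2 = (e₁ + e₂) * w - 64 := by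
    rw [hsum]; field_simp; ring
  funext i
  fin_cases i
  · simp [linPart, eigenEquiv, expandingEigenvalues]
    field_simp
    ring
  · simp [linPart, eigenEquiv, expandingEigenvalues]
    field_simp
    ring
  · simp [linPart, eigenEquiv, expandingEigenvalues, h64]
    field_simp
    linear_combination (4 * p.1 + p.2 2) * (hprod + hww)
  · simp [linPart, eigenEquiv, expandingEigenvalues, h64]
    field_simp
    linear_combination (4 * p.1 + p.2 2) * (hprod + hww)

theorem charpoly_diagMap (μ : Fin 3 → ℂ) :
    (diagMap μ).toLinearMap.charpoly = ∏ i, (X - C (μ i)) := by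
  have : (diagMap μ).toLinearMap = (Matrix.diagonal μ).toLin' := by
    refine LinearMap.ext fun y => funext fun i => ?_
    simp [Matrix.mulVec_diagonal]
  rw [this, Matrix.charpoly_toLin', Matrix.charpoly_diagonal]

theorem charpoly_smul_id (l : ℂ) : (l • LinearMap.id : ℂ →ₗ[ℂ] ℂ).charpoly = X - C l := by
  rw [← LinearMap.charpoly_toMatrix _ (Module.Basis.singleton Unit ℂ)]
  rw [Matrix.charpoly, Matrix.det_unique, Matrix.charmatrix_apply_eq, LinearMap.toMatrix_apply]
  simp

/-- The characteristic polynomial is invariant under conjugation and multiplicative on blocks, so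
its multiset of roots is read off the diagonal form. -/
theorem isHyperbolicOneAttracting_of_conj {L : (Fin 4 → ℂ) →L[ℂ] (Fin 4 → ℂ)}
    (P : (ℂ × (Fin 3 → ℂ)) ≃ₗ[ℂ] (Fin 4 → ℂ)) {l : ℂ} {μ : Fin 3 → ℂ}
    (h : ∀ p, L (P p) = P (l * p.1, diagMap μ p.2)) (hl0 : l ≠ 0) (hl : ‖l‖ < 1)
    (hμ : ∀ i, 1 < ‖μ i‖) : IsHyperbolicOneAttracting L := by
  have hL : L.toLinearMap = P.conj ((l • LinearMap.id).prodMap (diagMap μ).toLinearMap) := by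
    refine LinearMap.ext fun t => ?_
    obtain ⟨p, rfl⟩ := P.surjective t
    simpa [LinearEquiv.conj_apply] using h p
  have hroots : L.toLinearMap.charpoly.roots = l ::ₘ (Finset.univ.val.map μ) := by
    rw [hL, LinearEquiv.charpoly_conj, LinearMap.charpoly_prodMap, charpoly_smul_id,
      charpoly_diagMap]
    have e : (X - C l) * ∏ i, (X - C (μ i))
        = ((l ::ₘ (Finset.univ.val.map μ)).map fun x => X - C x).prod := by
      rw [Multiset.map_cons, Multiset.prod_cons, Multiset.map_map]
      rfl
    rw [e, roots_multiset_prod_X_sub_C]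
  have hfil : (Finset.univ.val.map μ).filter (fun x => ‖x‖ < 1) = 0 := by
    refine Multiset.filter_eq_nil.2 fun x hx => ?_
    obtain ⟨i, -, rfl⟩ := Multiset.mem_map.1 hx
    exact (hμ i).le.not_gt
  rw [IsHyperbolicOneAttracting, hroots]
  refine ⟨fun x hx => ?_, ?_⟩
  · rcases Multiset.mem_cons.1 hx with rfl | hx
    · exact ⟨hl0, hl.ne⟩
    · obtain ⟨i, -, rfl⟩ := Multiset.mem_map.1 hx
      exact ⟨norm_pos_iff.1 (zero_lt_one.trans (hμ i)), (hμ i).ne'⟩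
  · rw [Multiset.filter_cons_of_pos (p := fun x => ‖x‖ < 1) _ hl, hfil]
    rfl

/-! ### The two-cycle -/

theorem isTwoCycle_cyclePt {m a b c : ℂ} (ha : a ≠ 0) (hb : b ≠ 0) (hab : a ≠ b)
    (hc : c ^ 2 = a * b) (hc0 : c ≠ 0) :
    IsTwoCycle (vertices m a b) (cyclePt m c) (cyclePt m c ∘ swapPairs) := by
  have R := regular_cycleCoord (m := m) ha hb hab hc hc0
  have e : chartInv (cyclePt m c) (cycleCoord m c) = cyclePt m c := by
    rw [← chart_cyclePt, chartInv_chart_self]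
  have h1 := R.defined m c
  have h2 := R.JEA_eq m c
  have h3 := R.JEA_swapPairs m c
  rw [localMap_cycleCoord ha hb hab hc hc0, e] at h2 h3
  rw [e] at h1
  refine ⟨h1, h1.comp_perm _, h2, h3, fun h => ?_⟩
  have := congrFun h 0
  exact OnePoint.infty_ne_coe m this

theorem notMem_finitePart {n : ℕ} {z : Fin n → P1} {i : Fin n} (h : z i = ∞) :
    z ∉ finitePart n := by
  rintro ⟨x, rfl⟩
  exact OnePoint.coe_ne_infty (x i) h

theorem swapPairs_pow_two_mul (k : ℕ) : swapPairs ^ (2 * k) = 1 := by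
  have : swapPairs ^ 2 = 1 := by
    refine Equiv.ext fun i => ?_
    rw [sq, Equiv.Perm.mul_apply, coe_swapPairs]
    fin_cases i <;> rfl
  rw [pow_mul, this, one_pow]

/-- The swap produced by the first step is undone by the second. The formula needs regularity at a
point and at its image, which continuity at the fixed point supplies nearby. -/
theorem localReturn_eventuallyEq {α : Fin 4 → ℂ} {m c : ℂ} {t : Fin 4 → ℂ} (R : Regular α t)
    (hfix : localMap α t = t) :
    localReturn α (cyclePt m c) =ᶠ[𝓝 t] localMap α ∘ localMap α := by
  have hcont : Tendsto (localMap α) (𝓝 t) (𝓝 t) := by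
    have := R.contDiffAt_localMap.continuousAt
    rwa [ContinuousAt, hfix] at this
  filter_upwards [R.eventually, hcont.eventually R.eventually] with s h1 h2
  rw [localReturn, h1.JEA_eq, h2.JEA_swapPairs, chart_chartInv]
  rfl

/-! ### Orbits in local coordinates -/

section Orbits

variable {α : Fin 4 → ℂ} {m c : ℂ} {t : ℕ → Fin 4 → ℂ}

theorem coe_swapPairs_pow_succ (k : ℕ) :
    ((swapPairs ^ (k + 1) : Equiv.Perm (Fin 4)) : Fin 4 → Fin 4)
      = swapPairs ∘ (swapPairs ^ k : Equiv.Perm (Fin 4)) := by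
  rw [pow_succ']; rfl

/-- An orbit of `localMap` differs from an orbit of `JEA` by one more swap at every step. -/
theorem isOrbit_of_localMap (hR : ∀ k, Regular α (t k)) (ht : ∀ k, localMap α (t k) = t (k + 1)) :
    IsOrbit α fun k => chartInv (cyclePt m c) (t k) ∘ (swapPairs ^ k : Equiv.Perm (Fin 4)) := by
  intro k
  refine ⟨((hR k).defined m c).comp_perm _, ?_⟩
  simp only [JEA_comp_perm, (hR k).JEA_eq, ht k, coe_swapPairs_pow_succ]
  rfl

theorem isAffineOrbit_of_localMap (hR : ∀ k, Regular α (t k))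
    (ht : ∀ k, localMap α (t k) = t (k + 1)) (h0 : ∀ k, t k 0 ≠ 0) :
    IsAffineOrbit (rootPoly α) fun k => affinePt (t k) ∘ (swapPairs ^ k : Equiv.Perm (Fin 4)) := by
  intro k
  have h := ((hR k).isAffineStep (h0 k) (by rw [ht k]; exact h0 (k + 1))).comp_perm (swapPairs ^ k)
  rw [ht k] at h
  simp only [coe_swapPairs_pow_succ]
  exact h

theorem tendsto_norm_affinePt (h0 : ∀ k, t k 0 ≠ 0)
    (hlim : Tendsto (fun k => t k 0) atTop (𝓝 0)) :
    Tendsto (fun k => ‖affinePt (t k) ∘ (swapPairs ^ k : Equiv.Perm (Fin 4))‖) atTop atTop := by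
  have h1 : Tendsto (fun k => t k 0) atTop (𝓝[≠] 0) :=
    tendsto_nhdsWithin_iff.2 ⟨hlim, Eventually.of_forall h0⟩
  refine tendsto_atTop_mono (fun k => ?_) (tendsto_norm_inv_nhdsNE_zero_atTop.comp h1)
  -- The large entry, the inverse of `t k 0`, sits at the index that `swapPairs ^ k` sends to 0.
  have := norm_le_pi_norm (affinePt (t k) ∘ (swapPairs ^ k : Equiv.Perm (Fin 4)))
    ((swapPairs ^ k : Equiv.Perm (Fin 4)).symm 0)
  rw [Function.comp_apply, Equiv.apply_symm_apply] at this
  exact this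

end Orbits

/-! ### The stable disc -/

/-- If the local map is a saddle in the linear coordinates `P`, then there is a local stable disc,
and all its points but the center have diverging orbits in `ℂ⁴`. -/
theorem exists_isLocalStableDisc {α : Fin 4 → ℂ} {m c l : ℂ} {μ : Fin 3 → ℂ}
    (P : (ℂ × (Fin 3 → ℂ)) ≃L[ℂ] (Fin 4 → ℂ)) (R : Regular α (cycleCoord m c))
    (hfix : localMap α (cycleCoord m c) = cycleCoord m c)
    (hconj : ∀ p, fderiv ℂ (localMap α) (cycleCoord m c) (P p) = P (l * p.1, diagMap μ p.2))
    (hl0 : l ≠ 0) (hl : ‖l‖ < 1) (hμ : ∀ i, 2 ≤ ‖μ i‖)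
    (hP : ∀ a y, a ≠ 0 → ‖y‖ ≤ ‖a‖ → P (a, y) 0 ≠ 0) :
    ∃ γ : ℂ → Fin 4 → ℂ,
      IsLocalStableDisc α (cyclePt m c) ((fderiv ℂ (localMap α) (cycleCoord m c)).comp
        (fderiv ℂ (localMap α) (cycleCoord m c))) γ ∧
      ∀ s ∈ Metric.ball (0 : ℂ) 1, s ≠ 0 → ∃ Z : ℕ → Fin 4 → ℂ,
        incl (Z 0) = chartInv (cyclePt m c) (γ s) ∧ IsAffineOrbit (rootPoly α) Z ∧
        Tendsto (fun k => ‖Z k‖) atTop atTop := by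
  set b := cycleCoord m c with hb
  set M := fderiv ℂ (localMap α) b with hM
  set T : ℂ × (Fin 3 → ℂ) → Fin 4 → ℂ := fun p => b + P p with hT
  have hT0 : T 0 = b := by simp [hT]
  have hTc : Continuous T := by fun_prop
  have hTd : ∀ p, HasStrictFDerivAt T (P : (ℂ × (Fin 3 → ℂ)) →L[ℂ] (Fin 4 → ℂ)) p := fun p =>
    P.toContinuousLinearMap.hasStrictFDerivAt.const_add b
  set g : ℂ × (Fin 3 → ℂ) → ℂ × (Fin 3 → ℂ) := fun p => P.symm (localMap α (T p) - b) with hg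
  have hTg : ∀ p, localMap α (T p) = T (g p) := fun p => by simp [hT, hg]
  have hg0 : g 0 = 0 := by
    change P.symm (localMap α (T 0) - b) = 0
    rw [hT0, hfix, sub_self, map_zero]
  have hgd : HasStrictFDerivAt g ((l • ContinuousLinearMap.id ℂ ℂ).prodMap (diagMap μ)) 0 := by
    have h1 : HasStrictFDerivAt (localMap α) M (T 0) := by
      rw [hT0]; exact R.contDiffAt_localMap.hasStrictFDerivAt one_ne_zero
    have h2 := (P.symm.toContinuousLinearMap.hasStrictFDerivAt (x := localMap α (T 0) - b)).comp
      (0 : ℂ × (Fin 3 → ℂ)) ((h1.comp (0 : ℂ × (Fin 3 → ℂ)) (hTd 0)).sub_const b)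
    refine h2.congr_fderiv (ContinuousLinearMap.ext fun p => ?_)
    have h3 := congrArg P.symm (hconj p)
    rw [P.symm_apply_apply] at h3
    exact h3
  have hV : {p | Regular α (T p)} ∈ 𝓝 (0 : ℂ × (Fin 3 → ℂ)) := by
    have := hTc.tendsto 0
    rw [hT0] at this
    exact this.eventually R.eventually
  have hdiff : ∀ᶠ p in 𝓝 0, DifferentiableAt ℂ g p := by
    filter_upwards [hV] with p hp
    exact P.symm.differentiable.differentiableAt.comp p
      (((hp.contDiffAt_localMap.differentiableAt one_ne_zero).comp p
        (hTd p).hasFDerivAt.differentiableAt).sub_const b)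
  have hμ0 : ∀ i, μ i ≠ 0 := fun i => norm_pos_iff.1 (by linarith [hμ i])
  have hC : ‖diagMap fun i => (μ i)⁻¹‖ < 1 := by
    refine (norm_diagMap_le (K := 1 / 2) (by norm_num) fun i => ?_).trans_lt (by norm_num)
    rw [norm_inv, ← one_div]
    exact one_div_le_one_div_of_le (by norm_num) (hμ i)
  obtain ⟨r, ε, H, hrV⟩ := exists_isSaddle hg0
    (C := diagMap fun i => (μ i)⁻¹) (fun y => funext fun i => by simp [hμ0 i])
    (fun y => funext fun i => by simp [hμ0 i]) hl0 hl hC hdiff hgd hV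
  obtain ⟨f, hf, hinv⟩ := H.exists_invariant_graph
  have hf0 := H.hasDerivAt_graph hgd.hasFDerivAt hf hinv
  have hr := H.r_pos
  have hrs : ∀ s ∈ Metric.ball (0 : ℂ) 1, (r : ℂ) * s ∈ Metric.ball (0 : ℂ) r := by
    intro s hs
    rw [mem_ball_zero_iff] at hs ⊢
    rw [norm_mul, Complex.norm_real, Real.norm_of_nonneg hr.le]
    nlinarith
  have hr0 : (r : ℂ) ≠ 0 := Complex.ofReal_ne_zero.2 hr.ne'
  set Θ : ℂ × (Fin 3 → ℂ) → Fin 4 → P1 := fun p => chartInv (cyclePt m c) (T p) with hΘ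
  have hTinj : Function.Injective T := fun p q h => P.injective (add_left_cancel h)
  have hΘinj : Function.Injective Θ := (chartInv_injective _).comp hTinj
  have hΘopen : IsOpenMap Θ := (isOpenMap_chartInv _).comp
    ((Homeomorph.addLeft b).isOpenMap.comp P.toHomeomorph.isOpenMap)
  have hΘ0 : Θ 0 = cyclePt m c := by
    change chartInv _ (T 0) = _
    rw [hT0, hb, ← chart_cyclePt, chartInv_chart_self]
  have hΘc : Tendsto Θ (𝓝 0) (𝓝 (cyclePt m c)) := by
    have h1 := continuousAt_chartInv (cyclePt m c)
    rw [ContinuousAt, chartInv_chart_self, chart_cyclePt] at h1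
    have h2 := hTc.tendsto 0
    rw [hT0] at h2
    exact h1.comp h2
  have hgraph : ∀ a ∈ Metric.ball (0 : ℂ) r, ∀ k,
      g^[k] (a, f a) ∈ Metric.ball (0 : ℂ × (Fin 3 → ℂ)) r := by
    intro a ha k
    obtain ⟨a', ha', h1, -⟩ := H.iterate_graph hf hinv ha k
    rw [h1]; exact hf.mem ha'
  have hlim : ∀ a ∈ Metric.ball (0 : ℂ) r, Tendsto (fun k => g^[k] (a, f a)) atTop (𝓝 0) := by
    intro a ha
    have hκ : Tendsto (fun k => (‖l‖ + ε) ^ k * ‖a‖) atTop (𝓝 0) := by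
      have := H.contract
      have := H.ε_pos
      simpa using (tendsto_pow_atTop_nhds_zero_of_lt_one (r := ‖l‖ + ε) (by positivity)
        (by linarith)).mul_const ‖a‖
    refine squeeze_zero_norm (fun k => ?_) hκ
    obtain ⟨a', ha', h1, h2, -⟩ := H.iterate_graph hf hinv ha k
    rw [h1]
    exact (max_le le_rfl (hf.norm_le ha')).trans h2
  have hiter : ∀ p k, localMap α (T (g^[k] p)) = T (g^[k + 1] p) := fun p k => by
    rw [hTg, Function.iterate_succ_apply']
  have hγd : ∀ s ∈ Metric.ball (0 : ℂ) 1, HasDerivAt (fun s : ℂ => T (r * s, f (r * s)))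
      (P (r, (r : ℂ) • deriv f (r * s))) s := by
    intro s hs
    have h1 : HasDerivAt (fun s : ℂ => (r : ℂ) * s) r s := by
      simpa using (hasDerivAt_id s).const_mul (r : ℂ)
    have h2 : HasDerivAt f (deriv f (r * s)) (r * s) :=
      (hf.diff.differentiableAt (Metric.isOpen_ball.mem_nhds (hrs s hs))).hasDerivAt
    exact (hTd _).hasFDerivAt.comp_hasDerivAt s (h1.prodMk (h2.scomp s h1))
  have hder0 : deriv (fun s : ℂ => T (r * s, f (r * s))) 0 = P (r, 0) := by
    have h := (hγd 0 (by simp)).deriv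
    rw [mul_zero, hf0.deriv, smul_zero] at h
    exact h
  refine ⟨fun s => T (r * s, f (r * s)), ⟨⟨?_, ?_, ?_⟩, ?_, ?_, ?_⟩, ?_⟩
  · exact fun s hs => (hγd s hs).differentiableAt.differentiableWithinAt
  · intro s hs
    rw [(hγd s hs).deriv]
    exact fun h => hr0 (congrArg Prod.fst ((map_eq_zero_iff P P.injective).1 h))
  · have hc1 : Continuous ((Metric.ball (0 : ℂ) 1).domRestrict
        fun s : ℂ => T (r * s, f (r * s))) := continuousOn_iff_continuous_domRestrict.1
      fun s hs => (hγd s hs).continuousAt.continuousWithinAt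
    -- The rescaled first saddle coordinate is a continuous left inverse of the disc.
    refine IsEmbedding.of_comp hc1 (g := fun t => (r : ℂ)⁻¹ * (P.symm (t - b)).1)
      (by fun_prop) ?_
    have : (fun t => (r : ℂ)⁻¹ * (P.symm (t - b)).1) ∘ ((Metric.ball (0 : ℂ) 1).domRestrict
        fun s : ℂ => T (r * s, f (r * s))) = Subtype.val := by
      funext s
      simp [hT, hr0]
    rw [this]
    exact IsEmbedding.subtypeVal
  · simp only [chart_cyclePt, mul_zero, hf.map_zero]
    exact hT0
  · have hUo : IsOpen (Metric.ball (0 : ℂ × (Fin 3 → ℂ)) r ∩ g ⁻¹' Metric.ball 0 r) :=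
      H.diff.continuousOn.isOpen_inter_preimage Metric.isOpen_ball Metric.isOpen_ball
    have h0 : (0 : ℂ × (Fin 3 → ℂ)) ∈ Metric.ball (0 : ℂ × (Fin 3 → ℂ)) r :=
      Metric.mem_ball_self hr
    -- The neighbourhood constrains even times only; intersecting with the preimage of the ball
    -- keeps the odd iterates in the ball as well.
    refine ⟨Θ '' (Metric.ball 0 r ∩ g ⁻¹' Metric.ball 0 r), hΘopen _ hUo,
      ⟨0, ⟨h0, by rw [Set.mem_preimage, hg0]; exact h0⟩, hΘ0⟩, Set.Subset.antisymm ?_ ?_⟩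
    · rintro _ ⟨s, hs, rfl⟩
      have ha := hrs s hs
      refine ⟨fun k => Θ (g^[k] (r * s, f (r * s))) ∘ (swapPairs ^ k : Equiv.Perm (Fin 4)),
        isOrbit_of_localMap (fun k => hrV (hgraph _ ha k)) (hiter _), rfl, fun k => ?_, ?_⟩
      · refine ⟨g^[2 * k] (r * s, f (r * s)), ⟨hgraph _ ha _, ?_⟩, ?_⟩
        · rw [Set.mem_preimage, ← Function.iterate_succ_apply' g]
          exact hgraph _ ha _
        · simp only [swapPairs_pow_two_mul]; rfl
      · simp only [swapPairs_pow_two_mul, Equiv.Perm.coe_one, Function.comp_id]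
        exact hΘc.comp ((hlim _ ha).comp
          (tendsto_id.const_mul_atTop' (by norm_num : (0 : ℕ) < 2)))
    · rintro _ ⟨x, hx, rfl, hxN, -⟩
      obtain ⟨p, hp, hpx⟩ := hxN 0
      have hk : ∀ k, x (2 * k) = Θ (g^[2 * k] p) ∧ g^[2 * k] p ∈ Metric.ball 0 r ∧
          g^[2 * k + 1] p ∈ Metric.ball 0 r := by
        intro k
        induction k with
        | zero => exact ⟨hpx.symm, hp⟩
        | succ k ih =>
          obtain ⟨h1, h2, h3⟩ := ih
          have e : x (2 * (k + 1)) = Θ (g^[2 * (k + 1)] p) := by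
            rw [show 2 * (k + 1) = 2 * k + 1 + 1 by ring, (hx _).2, (hx _).2, h1]
            simp only [hΘ]
            rw [(hrV h2 : Regular α _).JEA_eq, hiter, (hrV h3 : Regular α _).JEA_swapPairs, hiter]
          obtain ⟨p', hp', hpx'⟩ := hxN (k + 1)
          -- Injectivity of the chart identifies the point witnessing membership in the
          -- neighbourhood with the iterate of p.
          have e' := hΘinj (hpx'.trans e)
          rw [e'] at hp'
          refine ⟨e, hp'.1, ?_⟩
          rw [Function.iterate_succ_apply']
          exact hp'.2
      have hall : ∀ k, g^[k] p ∈ Metric.ball (0 : ℂ × (Fin 3 → ℂ)) r := by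
        intro k
        rcases Nat.even_or_odd' k with ⟨j, rfl | rfl⟩
        · exact (hk j).2.1
        · exact (hk j).2.2
      have hpf := H.eq_graph_of_forall_mem hf hinv hall
      have hp1 : ‖p.1‖ < r := (norm_fst_le p).trans_lt (mem_ball_zero_iff.1 (hall 0))
      refine ⟨(r : ℂ)⁻¹ * p.1, ?_, ?_⟩
      · rw [mem_ball_zero_iff, norm_mul, norm_inv, Complex.norm_real, Real.norm_of_nonneg hr.le,
          inv_mul_lt_iff₀ hr, mul_one]
        exact hp1
      · simp only [mul_inv_cancel_left₀ hr0]
        rw [← hpf]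
        exact hpx
  -- As the graph is tangent to the attracting axis, the velocity of the disc at 0 is P(r, 0), an
  -- eigenvector of the squared derivative for l².
  · refine ⟨l ^ 2, ?_, ?_⟩
    · rw [norm_pow]
      exact pow_lt_one₀ (norm_nonneg _) hl two_ne_zero
    · rw [hder0, ContinuousLinearMap.comp_apply, hconj, hconj, ← map_smul]
      congr 1
      ext
      · simp [sq, mul_assoc]
      · simp
  · intro s hs hs0
    have ha := hrs s hs
    have hne : ∀ k, T (g^[k] (r * s, f (r * s))) 0 ≠ 0 := by
      intro k
      obtain ⟨a', ha', h1, -, h3⟩ := H.iterate_graph hf hinv ha k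
      rw [h1]
      have := hP a' (f a') (h3 (mul_ne_zero hr0 hs0)) (hf.norm_le ha')
      rw [← zero_add (P _ 0)] at this
      exact this
    refine ⟨fun k => affinePt (T (g^[k] (r * s, f (r * s)))) ∘ (swapPairs ^ k : Equiv.Perm (Fin 4)),
      incl_affinePt m c (hne 0), isAffineOrbit_of_localMap (fun k => hrV (hgraph _ ha k))
        (hiter _) hne, tendsto_norm_affinePt hne ?_⟩
    have h1 : Tendsto (fun k => T (g^[k] (r * s, f (r * s)))) atTop (𝓝 (T 0)) :=
      (hTc.tendsto 0).comp (hlim _ ha)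
    have h2 := tendsto_pi_nhds.1 h1 0
    rwa [hT0] at h2

/-! ### ### Center, half diagonals and the choice of the open set -/

theorem isParallelogram_vertices {α : Fin 4 → ℂ} (h : IsParallelogram α) :
    ∃ m a b : ℂ, α = vertices m a b ∧ a ≠ 0 ∧ b ≠ 0 ∧ a ≠ b ∧ a + b ≠ 0 := by
  obtain ⟨hinj, hsum⟩ := h
  have hne : ∀ i j : Fin 4, i ≠ j → α i - α j ≠ 0 := fun i j hij =>
    sub_ne_zero.2 (hinj.ne hij)
  refine ⟨(α 0 + α 2) / 2, (α 0 - α 2) / 2, (α 1 - α 3) / 2, ?_,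
    div_ne_zero (hne 0 2 (by decide)) two_ne_zero, div_ne_zero (hne 1 3 (by decide)) two_ne_zero,
    fun h => hne 0 1 (by decide) ?_, fun h => hne 0 3 (by decide) ?_⟩
  · funext i
    fin_cases i
    · change α 0 = (α 0 + α 2) / 2 + (α 0 - α 2) / 2
      ring
    · change α 1 = (α 0 + α 2) / 2 + (α 1 - α 3) / 2
      linear_combination -hsum / 2
    · change α 2 = (α 0 + α 2) / 2 - (α 0 - α 2) / 2
      ring
    · change α 3 = (α 0 + α 2) / 2 - (α 1 - α 3) / 2
      linear_combination -hsum / 2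
  · linear_combination h + hsum / 2
  · linear_combination h + hsum / 2

end EA

end

theorem mainTheorem3 :
    ∃ U : Set ℂ, IsOpen U ∧ U.Nonempty ∧
      ∀ α : Fin 4 → ℂ, EA.IsParallelogram α →
        ∃ z z' : Fin 4 → EA.P1,
          EA.IsTwoCycle α z z' ∧ z ∉ EA.finitePart 4 ∧ z' ∉ EA.finitePart 4 ∧
          (EA.CR (α 0) (α 1) (α 2) (α 3) ∈ U →
            ∃ L : (Fin 4 → ℂ) →L[ℂ] (Fin 4 → ℂ),
              HasFDerivAt (EA.localReturn α z) L (EA.chart z z) ∧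
              EA.IsHyperbolicOneAttracting L ∧
              ∃ γ : ℂ → Fin 4 → ℂ,
                EA.IsLocalStableDisc α z L γ ∧
                ∀ s ∈ Metric.ball (0 : ℂ) 1, s ≠ 0 →
                  ∃ Z : ℕ → Fin 4 → ℂ,
                    EA.incl (Z 0) = EA.chartInv z (γ s) ∧
                    EA.IsAffineOrbit (EA.rootPoly α) Z ∧
                    Tendsto (fun k => ‖Z k‖) atTop atTop) := by
  -- In terms of w = 8 − 8/CR the set is |w − 4| < 1/100; it contains CR = 2, where w = 4.
  refine ⟨{x | x ≠ 0} ∩ {x | ‖8 - 8 / x - 4‖ < 1 / 100}, ?_, ⟨2, by simp, ?_⟩, ?_⟩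
  · refine ContinuousOn.isOpen_inter_preimage (f := fun x : ℂ => ‖8 - 8 / x - 4‖)
      (t := Set.Iio (1 / 100)) ?_ isOpen_ne isOpen_Iio
    refine ContinuousOn.norm (ContinuousOn.sub (ContinuousOn.sub continuousOn_const
      (continuousOn_const.div continuousOn_id fun x hx => hx)) continuousOn_const)
  · norm_num
  intro α hα
  obtain ⟨m, a, b, rfl, ha, hb, hab, hab'⟩ := EA.isParallelogram_vertices hα
  obtain ⟨c, hc⟩ := IsAlgClosed.exists_pow_nat_eq (a * b) (n := 2) (by norm_num)
  have hc0 : c ≠ 0 := by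
    rintro rfl
    exact mul_ne_zero ha hb (by rw [← hc]; ring)
  refine ⟨EA.cyclePt m c, EA.cyclePt m c ∘ EA.swapPairs, EA.isTwoCycle_cyclePt ha hb hab hc hc0,
    EA.notMem_finitePart (i := 0) rfl, EA.notMem_finitePart (i := 1) rfl, ?_⟩
  rintro ⟨-, hU⟩
  set w : ℂ := -2 * (a - b) ^ 2 / c ^ 2 with hw
  have hwCR : 8 - 8 / EA.CR (m + a) (m + b) (m - a) (m - b) = w := by
    have : EA.CR (m + a) (m + b) (m - a) (m - b) = 4 * (a * b) / (a + b) ^ 2 := by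
      rw [EA.CR]
      congr 1 <;> ring
    rw [this, hw, hc]
    field_simp
    ring
  have hw4 : ‖w - 4‖ < 1 / 100 := by rw [← hwCR]; exact hU
  have hw0 : w ≠ 0 := by
    have := sub_ne_zero.2 hab
    rw [hw]
    exact div_ne_zero (mul_ne_zero (by norm_num) (pow_ne_zero 2 this)) (pow_ne_zero 2 hc0)
  obtain ⟨e₁, e₂, hprod, hsum, he1, he3⟩ := EA.exists_eigenvalue hw4
  have hn1 : ‖e₁‖ < 4 := by
    have := norm_add_le (e₁ - 3) 3
    rw [sub_add_cancel] at this
    norm_num at this he1 ⊢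
    linarith
  -- The product of the two roots is 48 and the first has modulus below 4.
  have hn2 : 12 < ‖e₂‖ := by
    have h := congrArg norm hprod
    rw [norm_mul] at h
    norm_num at h
    nlinarith [norm_nonneg e₁, norm_nonneg e₂]
  have hne : e₁ ≠ e₂ := by
    rintro rfl
    linarith
  have hwn : ‖w‖ < 4.01 := by
    have := norm_add_le (w - 4) 4
    rw [sub_add_cancel] at this
    norm_num at this hw4 ⊢
    linarith
  have hμ : ∀ i, 2 ≤ ‖EA.expandingEigenvalues w e₂ i‖ := by
    intro i
    fin_cases i
    · change 2 ≤ ‖1 - w‖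
      have h1 := norm_sub_norm_le (3 : ℂ) (-(w - 4))
      rw [show (3 : ℂ) - -(w - 4) = -(1 - w) by ring, norm_neg, norm_neg] at h1
      norm_num at h1 hw4 ⊢
      linarith
    · change 2 ≤ ‖1 - 64 / w‖
      have h1 := norm_sub_norm_le (64 / w) 1
      rw [norm_sub_rev] at h1
      have h2 : 15 ≤ ‖64 / w‖ := by
        rw [norm_div, le_div_iff₀ (norm_pos_iff.2 hw0)]
        norm_num at hwn ⊢
        linarith
      norm_num at h1 h2 ⊢
      linarith
    · change 2 ≤ ‖e₂ - 3‖
      have h1 := norm_sub_norm_le e₂ 3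
      norm_num at h1 ⊢
      linarith
  have R := EA.regular_cycleCoord (m := m) ha hb hab hc hc0
  have hfix := EA.localMap_cycleCoord (m := m) ha hb hab hc hc0
  set P := EA.eigenEquiv c w e₁ e₂ hc0 hne with hP
  have hconj : ∀ p, fderiv ℂ (EA.localMap (EA.vertices m a b)) (EA.cycleCoord m c) (P p)
      = P ((e₁ - 3) * p.1, EA.diagMap (EA.expandingEigenvalues w e₂) p.2) := fun p => by
    rw [EA.fderiv_localMap_cycleCoord ha hb hab hc hc0 hw, hP,
      EA.linPart_eigenEquiv hc0 hne hw0 hprod hsum]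
  have hl0 : e₁ - 3 ≠ 0 := sub_ne_zero.2 he3
  refine ⟨(fderiv ℂ (EA.localMap (EA.vertices m a b)) (EA.cycleCoord m c)).comp
    (fderiv ℂ (EA.localMap (EA.vertices m a b)) (EA.cycleCoord m c)), ?_, ?_, ?_⟩
  · rw [EA.chart_cyclePt]
    have hd := (R.contDiffAt_localMap.differentiableAt one_ne_zero).hasFDerivAt
    refine HasFDerivAt.congr_of_eventuallyEq ?_ (EA.localReturn_eventuallyEq R hfix)
    refine HasFDerivAt.comp _ ?_ hd
    rw [hfix]
    exact hd
  · refine EA.isHyperbolicOneAttracting_of_conj P (l := (e₁ - 3) ^ 2)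
      (μ := fun i => EA.expandingEigenvalues w e₂ i ^ 2) (fun p => ?_) (pow_ne_zero 2 hl0) ?_ ?_
    · rw [ContinuousLinearMap.comp_apply, hconj, hconj]
      congr 1
      ext
      · simp [sq, mul_assoc]
      · simp [sq, mul_assoc]
    · rw [norm_pow]
      exact pow_lt_one₀ (norm_nonneg _) he1 two_ne_zero
    · intro i
      rw [norm_pow]
      exact one_lt_pow₀ (by linarith [hμ i]) two_ne_zero
  · refine EA.exists_isLocalStableDisc P.toContinuousLinearEquiv R hfix hconj hl0 he1 hμ ?_
    -- The coefficients 1/4 in the eigenbasis bound the contribution of y to the coordinate 1/z₀ by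
    -- half of that of x, so the two cannot cancel.
    intro x y hx hy h0
    have h1 : (x + y 0 / 4 + y 2 / 4) / c = 0 := h0
    have h2 : x = -(y 0 / 4 + y 2 / 4) := by
      rw [div_eq_zero_iff, or_iff_left hc0] at h1
      linear_combination h1
    have h3 := norm_add_le (y 0 / 4) (y 2 / 4)
    rw [← norm_neg, ← h2, norm_div, norm_div] at h3
    have h4 := norm_le_pi_norm y 0
    have h5 := norm_le_pi_norm y 2
    have h6 := norm_pos_iff.2 hx
    norm_num at h3
    linarith
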